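/- An order is a reduced commutative ring $R$ that is free and finitely generated as a $\mathbb{Z}$-module; let $K$ be its total quotient ring. A fractional $R$-ideal is a finitely generated $R$-submodule $I\subseteq K$ with $I\otimes_{\mathbb Z}\mathbb{Q}=K$. Put $(I:J)=\{x\in K : xJ\subseteq I\}$; the multiplicator ring of $I$ is $(I:I)$. An over-order of $R$ is a fractional $R$-ideal that is a subring of $K$ containing $R$. An order $S$ is Gorenstein if $(S:(S:I))=I$ for every fractional $S$-ideal $I$, and $R$ is Bass if all its over-orders are Gorenstein. $\mathrm{ICM}(R)$ is the set of fractional $R$-ideals modulo isomorphism of $R$-modules, and $[I]$ is the class of $I$. For monic $m,c\in\mathbb{Z}[x]$ let $\mathcal{M}_{m,c}(\mathbb{Z})$ be the set of integral square matrices of size $\deg c$ with minimal polynomial $m$ and characteristic polynomial $c$, and let $\sim$ be conjugation by $\mathrm{GL}_{\deg c}(\mathbb{Z})$. Let $f\in\mathbb{Z}[x]$ be monic and square-free, let $R=\mathbb{Z}[x]/(f)$, and let $\alpha\in R$ be the class of $x$. (a) There is a bijection $\mathcal{M}_{f,f}(\mathbb{Z})/{\sim}\;\longleftrightarrow\;\mathrm{ICM}(R)$,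 under which the class of a matrix $A$ corresponds to $[I]$ if and only if $A$ is the matrix of multiplication by $\alpha$ on $I$ with respect to some $\mathbb{Z}$-basis of $I$. (b) Assume that $R$ is Bass and let $N\ge 1$ be an integer. Let $\mathcal{C}$ be the class of $R$-modules $I_1\oplus\dots\oplus I_N$, where the $I_i$ are fractional $R$-ideals with $(I_i:I_i)\subseteq(I_{i+1}:I_{i+1})$ for $1\le i<N$. There is a bijection $\mathcal{M}_{f,f^N}(\mathbb{Z})/{\sim}\;\longleftrightarrow\;\mathcal{C}/{\simeq_R}$, under which the class of $A$ corresponds to the isomorphism class of $M\in\mathcal{C}$ if and only if $A$ is the matrix of multiplication by $\alpha$ on $M$ with respect to some $\mathbb{Z}$-basis of $M$. Moreover, two modules $I_1\oplus\dots\oplus I_N$ and $I'_1\oplus\dots\oplus I'_N$ in $\mathcal{C}$ are isomorphic as $R$-modules if and only if $(I_i:I_i)=(I'_i:I'_i)$ for every $i$ and $[I_1\cdots I_N]=[I'_1\cdots I'_N]$ in $\mathrm{ICM}(R)$. -/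

import Mathlib

open Polynomial

universe u v

section Ideals

variable (R : Type u) (K : Type v) [CommRing R] [CommRing K] [Algebra R K]

/-- For an order `R` with total quotient ring `K`: a fractional `R`-ideal is a finitely generated
`R`-submodule `I` of `K` with `I ⊗ ℚ = K`, i.e. every element of `K` has a nonzero integral
multiple in `I`. -/
structure IsFracIdeal (I : Submodule R K) : Prop where
  fg : I.FG
  full : ∀ x : K, ∃ n : ℤ, n ≠ 0 ∧ n • x ∈ I

/-- The set of fractional `R`-ideals. -/
def FracIdeal : Type v := {I : Submodule R K // IsFracIdeal R K I}

/-- The order `R` is Gorenstein: `(R : (R : I)) = I` for every fractional `R`-ideal `I`.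
Here `1 : Submodule R K` is the image of `R` in `K`, and `I / J` is the ideal quotient
`(I : J) = {x ∈ K | x J ⊆ I}`. -/
def IsGorensteinOrder : Prop :=
  ∀ I : Submodule R K, IsFracIdeal R K I → (1 : Submodule R K) / (1 / I) = I

/-- The order `R` is Bass: every over-order of `R` (a subring of `K` containing `R` which is a
fractional `R`-ideal) is Gorenstein. -/
def IsBassOrder : Prop :=
  ∀ S : Subalgebra R K, IsFracIdeal R K (Subalgebra.toSubmodule S) → IsGorensteinOrder S K

/-- Isomorphism of fractional ideals as `R`-modules. -/
def FracIdeal.isoSetoid : Setoid (FracIdeal R K) where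
  r I J := Nonempty (I.1 ≃ₗ[R] J.1)
  iseqv := ⟨fun _ => ⟨LinearEquiv.refl R _⟩, fun ⟨e⟩ => ⟨e.symm⟩, fun ⟨e⟩ ⟨e'⟩ => ⟨e.trans e'⟩⟩

/-- The ideal class monoid of `R` (its underlying set): fractional `R`-ideals up to
isomorphism of `R`-modules. -/
def ICM : Type v := Quotient (FracIdeal.isoSetoid R K)

variable {R K}

/-- The class of a fractional ideal. -/
def ICM.mk (I : FracIdeal R K) : ICM R K := Quotient.mk (FracIdeal.isoSetoid R K) I

/-- The multiplicator ring `(I : I)`, as a submodule of `K`. -/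
def FracIdeal.multRing (I : FracIdeal R K) : Submodule R K := I.1 / I.1

theorem IsFracIdeal.mul {I J : Submodule R K} (hI : IsFracIdeal R K I) (hJ : IsFracIdeal R K J) :
    IsFracIdeal R K (I * J) := by
  refine ⟨hI.fg.mul hJ.fg, fun x => ?_⟩
  obtain ⟨n, hn, hx⟩ := hI.full x
  obtain ⟨m, hm, h1⟩ := hJ.full 1
  refine ⟨n * m, mul_ne_zero hn hm, ?_⟩
  have h : (n * m) • x = (n • x) * (m • (1 : K)) := by
    simp only [zsmul_eq_mul]
    push_cast
    ring
  rw [h]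
  exact Submodule.mul_mem_mul hx h1

/-- The product `I₁ ⋯ I_N` of `N ≥ 1` fractional ideals. -/
def FracIdeal.prod {N : ℕ} (hN : 0 < N) (I : Fin N → FracIdeal R K) : FracIdeal R K :=
  ⟨∏ i, (I i).1, Finset.prod_induction_nonempty (fun i => (I i).1) (IsFracIdeal R K)
    (fun _ _ => IsFracIdeal.mul) ⟨⟨0, hN⟩, Finset.mem_univ _⟩ (fun i _ => (I i).2)⟩

variable (R K)

/-- Sequences `I₁, …, I_N` of fractional ideals with `(I_i : I_i) ⊆ (I_{i+1} : I_{i+1})`. -/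
def FracIdealChain (N : ℕ) : Type v :=
  {I : Fin N → FracIdeal R K // Monotone fun i => (I i).multRing}

variable {R K}

/-- The `R`-module `I₁ ⊕ ⋯ ⊕ I_N`. -/
abbrev FracIdealChain.directSum {N : ℕ} (I : FracIdealChain R K N) : Type v :=
  ∀ i, (I.1 i).1

variable (R K)

/-- Isomorphism of the `R`-modules `I₁ ⊕ ⋯ ⊕ I_N`. -/
def FracIdealChain.isoSetoid (N : ℕ) : Setoid (FracIdealChain R K N) where
  r I J := Nonempty (I.directSum ≃ₗ[R] J.directSum)
  iseqv := ⟨fun _ => ⟨LinearEquiv.refl R _⟩, fun ⟨e⟩ => ⟨e.symm⟩, fun ⟨e⟩ ⟨e'⟩ => ⟨e.trans e'⟩⟩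

/-- Isomorphism classes of the `R`-modules `I₁ ⊕ ⋯ ⊕ I_N`. -/
def ChainClasses (N : ℕ) : Type v := Quotient (FracIdealChain.isoSetoid R K N)

variable {R K}

/-- The isomorphism class of `I₁ ⊕ ⋯ ⊕ I_N`. -/
def ChainClasses.mk {N : ℕ} (I : FracIdealChain R K N) : ChainClasses R K N :=
  Quotient.mk (FracIdealChain.isoSetoid R K N) I

end Ideals

section Matrices

/-- Square integral matrices of size `deg c` with minimal polynomial `m` (over `ℚ`) and
characteristic polynomial `c`. -/
def IntMatrices (m c : ℤ[X]) : Type :=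
  {A : Matrix (Fin c.natDegree) (Fin c.natDegree) ℤ //
    minpoly ℚ (A.map (Int.castRingHom ℚ)) = m.map (Int.castRingHom ℚ) ∧ A.charpoly = c}

/-- Conjugacy by `GL_n(ℤ)`. -/
def IntMatrices.conjSetoid (m c : ℤ[X]) : Setoid (IntMatrices m c) where
  r A B := ∃ O : GL (Fin c.natDegree) ℤ, O.1 * A.1 * (O⁻¹).1 = B.1
  iseqv := by
    refine ⟨fun A => ⟨1, by simp⟩, ?_, ?_⟩
    · rintro A B ⟨O, h⟩
      refine ⟨O⁻¹, ?_⟩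
      rw [← h]
      simp [mul_assoc]
    · rintro A B C ⟨O, h⟩ ⟨P, h2⟩
      refine ⟨P * O, ?_⟩
      rw [← h2, ← h, mul_inv_rev, Units.val_mul, Units.val_mul]
      simp only [mul_assoc]

/-- Conjugacy classes of integral matrices with minimal polynomial `m` and characteristic
polynomial `c`. -/
def MatrixClasses (m c : ℤ[X]) : Type := Quotient (IntMatrices.conjSetoid m c)

/-- The conjugacy class of a matrix. -/
def MatrixClasses.mk {m c : ℤ[X]} (A : IntMatrices m c) : MatrixClasses m c :=
  Quotient.mk (IntMatrices.conjSetoid m c) A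

/-- For a module `M` over `ℤ[x]/(f)`: `A` is the matrix of multiplication by the class of `x`
with respect to some `ℤ`-basis of `M`. -/
def IsMatrixOfRoot (f : ℤ[X]) {n : ℕ} (A : Matrix (Fin n) (Fin n) ℤ) (M : Type u)
    [AddCommGroup M] [Module (AdjoinRoot f) M] : Prop :=
  ∃ w : Module.Basis (Fin n) ℤ M,
    LinearMap.toMatrix w w
      (DistribSMul.toAddMonoidHom M (AdjoinRoot.root f)).toIntLinearMap = A

end Matrices

/-!
An `R`-module with a `ℤ`-basis, together with multiplication by the class `α` of `x`, is the same
thing as an integral matrix annihilated by `f`, and changing the basis conjugates the matrix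
(`exists_matrixClasses_equiv`). What remains is to recognize which modules arise, and to classify
them.

*Recognition.* Let `K` be the total quotient ring, a finite reduced `ℚ`-algebra generated by `α`.
A full lattice in `K ^ N` gives a matrix with minimal polynomial `f` and characteristic polynomial
`f ^ N` (`exists_isMatrixOfRoot`). Conversely, if `A` has characteristic polynomial `f ^ N`, then
every `g(A)` has the characteristic polynomial of `g(α)` acting on `K ^ N`, so every element of `K`
has `N` times its trace on the extension of scalars `V` of the module to `K`. Since the maximal
ideals of `K` are generated by idempotents, whose traces are dimensions, `V` has the same rank `N`
everywhere, and so it is free (`nonempty_equiv_pi_of_scalarTrace`, `exists_lattice_of_charpoly`).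
For `N = 1` this is the first claim.

*Decomposition.* Let `R` be Bass. A formal computation shows that every fractional ideal `I` is
invertible over its multiplicator ring (`IsBassOrder.mul_div_cancel`). For a lattice `M` in `K ^ N`
with multiplicator ring `S`, let `M†` be its dual under the trace of the standard bilinear form.
The ideal `M M†` has trace dual `S`, because `M†† = M`; so it is a fractional ideal with
multiplicator ring `S`, hence invertible, and the `S`-linear functionals on `M` have values
generating `S` (`one_mem_span_pairing`). Working modulo a fixed integer `m`, a single functional has
an image `I` with `I + m S = S` (`exists_pairing_sub_one_mem`). If `m` is divisible by a common
denominator `d` of all over-orders, which exists by nondegeneracy of the trace form, then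
`(I : I) = S`; so `I` is invertible over `S`, the functional splits, and induction on `N` gives a
sum of ideals with increasing multiplicator rings (`exists_splitting`, `exists_chain_equiv`).

*Classification.* From `I ⊕ J ≃ (I : I) ⊕ IJ` one gets
`I₁ ⊕ ⋯ ⊕ I_N ≃ S₁ ⊕ ⋯ ⊕ S_{N-1} ⊕ I₁ ⋯ I_N` (`nonempty_normalForm`), so the multiplicator rings and
the class of the product determine the module. Conversely an isomorphism is a matrix over `K`,
whose determinant identifies the products of the ideals, and whose minors, expanded in
`G H = 1`, show that the multiplicator rings agree (`multRing_le_of_matrix`).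
-/

namespace OrderLattice

/-! ### Full lattices -/

section Lattice

variable (R : Type*) {V : Type*} [CommRing R] [AddCommGroup V] [Module R V]

/-- A full lattice: a finitely generated `R`-submodule of `V` that contains a nonzero integral
multiple of every vector. For `V = K` this is the notion of a fractional ideal. -/
structure IsFullLattice (M : Submodule R V) : Prop where
  fg : M.FG
  full : ∀ x : V, ∃ n : ℤ, n ≠ 0 ∧ n • x ∈ M

end Lattice

section

variable {R K : Type*} [CommRing R] [CommRing K] [Algebra R K]

theorem isFullLattice_iff {I : Submodule R K} : IsFullLattice R I ↔ IsFracIdeal R K I :=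
  ⟨fun h => ⟨h.1, h.2⟩, fun h => ⟨h.1, h.2⟩⟩

end

section RatBasis

variable {V : Type*} [AddCommGroup V] [Module ℚ V]

theorem isLocalizedModule_of_full {M : Type*} [AddCommGroup M] (j : M →ₗ[ℤ] V)
    (hj : Function.Injective j) (hfull : ∀ x : V, ∃ n : ℤ, n ≠ 0 ∧ ∃ m, j m = n • x) :
    IsLocalizedModule (nonZeroDivisors ℤ) j where
  map_units s := by
    have hs : ((s : ℤ) : ℚ) ≠ 0 := by exact_mod_cast nonZeroDivisors.ne_zero s.2
    rw [Module.End.isUnit_iff]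
    refine ⟨fun x y hxy => ?_, fun x => ⟨((s : ℤ) : ℚ)⁻¹ • x, ?_⟩⟩
    · simp only [Module.algebraMap_end_apply, ← Int.cast_smul_eq_zsmul ℚ] at hxy
      exact smul_right_injective V hs hxy
    · simp only [Module.algebraMap_end_apply, ← Int.cast_smul_eq_zsmul ℚ]
      rw [smul_smul, mul_inv_cancel₀ hs, one_smul]
  surj y := by
    obtain ⟨n, hn, m, hm⟩ := hfull y
    exact ⟨(m, ⟨n, mem_nonZeroDivisors_of_ne_zero hn⟩), hm.symm⟩
  exists_of_eq h := ⟨1, by rw [hj h]⟩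

theorem torsionFree_of_injective {M : Type*} [AddCommGroup M] (j : M →ₗ[ℤ] V)
    (hj : Function.Injective j) : Module.IsTorsionFree ℤ M := by
  have : Module.IsTorsionFree ℤ V := Module.IsTorsionFree.trans_faithfulSMul ℤ ℚ V
  exact hj.moduleIsTorsionFree j (fun n m => map_smul j n m)

theorem exists_int_smul_mem_span {ι : Type*} [Finite ι] (b : Module.Basis ι ℚ V) (x : V) :
    ∃ n : ℤ, n ≠ 0 ∧ n • x ∈ Submodule.span ℤ (Set.range b) := by
  cases nonempty_fintype ι
  obtain ⟨d, hd⟩ := IsLocalization.exist_integer_multiples (nonZeroDivisors ℤ) Finset.univ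
    (fun i => b.repr x i)
  refine ⟨d, nonZeroDivisors.ne_zero d.2, ?_⟩
  rw [← b.sum_repr x, Finset.smul_sum]
  refine Submodule.sum_mem _ fun i _ => ?_
  obtain ⟨k, hk⟩ := hd i (Finset.mem_univ i)
  rw [← smul_assoc, ← hk, algebraMap_int_eq, eq_intCast, Int.cast_smul_eq_zsmul]
  exact Submodule.smul_mem _ _ (Submodule.subset_span ⟨i, rfl⟩)

variable {R : Type*} [CommRing R] [Module.Finite ℤ R] [Module R V]

/-- A full lattice in a rational vector space is spanned over `ℤ` by a rational basis. -/
theorem IsFullLattice.exists_basis {M : Submodule R V} (hM : IsFullLattice R M) :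
    ∃ (n : ℕ) (b : Module.Basis (Fin n) ℚ V),
      Submodule.span ℤ (Set.range b) = M.restrictScalars ℤ := by
  have : Module.Finite R M := Module.Finite.iff_fg.2 hM.fg
  have : Module.Finite ℤ M := Module.Finite.trans R M
  let j : M →ₗ[ℤ] V := M.subtype.restrictScalars ℤ
  have hj : Function.Injective j := Subtype.val_injective
  have := torsionFree_of_injective j hj
  have hloc := isLocalizedModule_of_full j hj fun x => by
    obtain ⟨n, hn, hx⟩ := hM.full x
    exact ⟨n, hn, ⟨_, hx⟩, rfl⟩
  let b := Module.finBasis ℤ M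
  refine ⟨_, b.ofIsLocalizedModule ℚ (nonZeroDivisors ℤ) j, ?_⟩
  rw [Module.Basis.ofIsLocalizedModule_span]
  ext x
  constructor
  · rintro ⟨m, rfl⟩; exact m.2
  · intro hx; exact ⟨⟨x, hx⟩, rfl⟩

end RatBasis

/-! ### Duality for the trace pairing -/

section Trace

variable {K : Type*} [CommRing K] [Algebra ℚ K] [FiniteDimensional ℚ K] [IsReduced K]

theorem isSemisimpleRing_of_reduced (K : Type*) [CommRing K] [Algebra ℚ K]
    [FiniteDimensional ℚ K] [IsReduced K] : IsSemisimpleRing K := by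
  have : IsArtinianRing K := IsArtinianRing.of_finite ℚ K
  exact IsArtinianRing.isSemisimpleRing_of_isReduced K

/-- Nondegeneracy of the trace form: every principal ideal is generated by an idempotent, whose
trace is the dimension of the ideal. -/
theorem eq_zero_of_trace_mul_eq_zero {x : K} (h : ∀ y, Algebra.trace ℚ K (x * y) = 0) : x = 0 := by
  have := isSemisimpleRing_of_reduced K
  obtain ⟨e, he, hxe⟩ := IsSemisimpleRing.ideal_eq_span_idempotent (Ideal.span {x})
  have hmem : e ∈ Ideal.span {x} := hxe ▸ Ideal.mem_span_singleton_self e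
  obtain ⟨y, rfl⟩ := Ideal.mem_span_singleton'.1 hmem
  have hid : IsIdempotentElem (Algebra.lmul ℚ K (y * x)) := he.map _
  have h0 : Algebra.lmul ℚ K (y * x) = 0 := by
    refine (LinearMap.IsIdempotentElem.trace_eq_zero_iff hid).1 ?_
    have := h y
    rwa [mul_comm, Algebra.trace_apply] at this
  have h1 : y * x = 0 := by simpa using LinearMap.congr_fun h0 1
  rw [h1] at hxe
  simpa [Ideal.span_singleton_eq_bot] using hxe

end Trace

section Dual

variable {R K V : Type*} [CommRing R] [CommRing K] [Algebra R K] [Algebra ℚ K]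
  [AddCommGroup V] [Module R V] [Module K V] [Module ℚ V] [IsScalarTower R K V]
  [IsScalarTower ℚ K V]

/-- The rational bilinear form `(v, w) ↦ Tr (β v w)` attached to a `K`-bilinear form `β`. -/
noncomputable def traceForm (β : V →ₗ[K] V →ₗ[K] K) : LinearMap.BilinForm ℚ V :=
  LinearMap.mk₂ ℚ (fun v w => Algebra.trace ℚ K (β v w))
    (fun _ _ _ => by simp) (fun q v w => by
      rw [← algebraMap_smul K q v, map_smul, LinearMap.smul_apply, algebraMap_smul, map_smul])
    (fun _ _ _ => by simp) (fun q v w => by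
      rw [← algebraMap_smul K q w, map_smul, algebraMap_smul, map_smul])

@[simp] theorem traceForm_apply (β : V →ₗ[K] V →ₗ[K] K) (v w : V) :
    traceForm β v w = Algebra.trace ℚ K (β v w) := rfl

/-- The trace dual `{v | Tr (β v w) ∈ ℤ for all w ∈ M}` of an `R`-lattice `M`. -/
noncomputable def traceDual (β : V →ₗ[K] V →ₗ[K] K) (M : Submodule R V) : Submodule R V where
  __ := (traceForm β).dualSubmodule (M.restrictScalars ℤ)
  smul_mem' r v hv w hw := by
    have h := hv (r • w) (M.smul_mem r hw)
    rw [traceForm_apply, ← algebraMap_smul K r w, map_smul] at h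
    rw [traceForm_apply, ← algebraMap_smul K r v, map_smul, LinearMap.smul_apply]
    exact h

theorem restrictScalars_traceDual (β : V →ₗ[K] V →ₗ[K] K) (M : Submodule R V) :
    (traceDual β M).restrictScalars ℤ =
      (traceForm β).dualSubmodule (M.restrictScalars ℤ) := rfl

theorem mem_traceDual {β : V →ₗ[K] V →ₗ[K] K} {M : Submodule R V} {v : V} :
    v ∈ traceDual β M ↔ ∀ w ∈ M, ∃ n : ℤ, Algebra.trace ℚ K (β v w) = n := by
  refine forall₂_congr fun w _ => ?_
  rw [Submodule.mem_one]
  exact ⟨fun ⟨n, hn⟩ => ⟨n, by simpa using hn.symm⟩, fun ⟨n, hn⟩ => ⟨n, by simpa using hn.symm⟩⟩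

variable [FiniteDimensional ℚ K] [IsReduced K]

theorem traceForm_nondegenerate {β : V →ₗ[K] V →ₗ[K] K} (hsymm : ∀ v w, β v w = β w v)
    (hβ : ∀ v, (∀ w, β v w = 0) → v = 0) : (traceForm β).Nondegenerate := by
  have key : ∀ v, (∀ w, traceForm β v w = 0) → v = 0 := fun v hv =>
    hβ v fun w => eq_zero_of_trace_mul_eq_zero fun y => by
      have := hv (y • w)
      rwa [traceForm_apply, map_smul, smul_eq_mul, mul_comm] at this
  refine ⟨key, fun v hv => key v fun w => ?_⟩
  have := hv w
  rwa [traceForm_apply, hsymm] at this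

variable [Module.Finite ℤ R]

theorem IsFullLattice.traceDual {β : V →ₗ[K] V →ₗ[K] K} (hsymm : ∀ v w, β v w = β w v)
    (hβ : ∀ v, (∀ w, β v w = 0) → v = 0) {M : Submodule R V} (hM : IsFullLattice R M) :
    IsFullLattice R (traceDual β M) := by
  obtain ⟨n, b, hb⟩ := hM.exists_basis
  have hB := traceForm_nondegenerate hsymm hβ
  have hd := LinearMap.BilinForm.dualSubmodule_span_of_basis (R := ℤ) (traceForm β) hB b
  rw [hb, ← restrictScalars_traceDual] at hd
  refine ⟨?_, fun x => ?_⟩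
  · refine Submodule.FG.of_restrictScalars ℤ ?_
    rw [hd]
    exact Submodule.fg_span (Set.finite_range _)
  · obtain ⟨k, hk, hx⟩ := exists_int_smul_mem_span ((traceForm β).dualBasis hB b) x
    rw [← hd] at hx
    exact ⟨k, hk, hx⟩

theorem IsFullLattice.traceDual_traceDual {β : V →ₗ[K] V →ₗ[K] K} (hsymm : ∀ v w, β v w = β w v)
    (hβ : ∀ v, (∀ w, β v w = 0) → v = 0) {M : Submodule R V} (hM : IsFullLattice R M) :
    OrderLattice.traceDual β (OrderLattice.traceDual β M) = M := by
  obtain ⟨n, b, hb⟩ := hM.exists_basis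
  have hB := traceForm_nondegenerate hsymm hβ
  have hS : (traceForm β).IsSymm := ⟨fun v w => by simp [hsymm v w]⟩
  have hd := LinearMap.BilinForm.dualSubmodule_dualSubmodule_of_basis (R := ℤ) (traceForm β) hB hS b
  rw [hb, ← restrictScalars_traceDual, ← restrictScalars_traceDual] at hd
  exact Submodule.restrictScalars_injective ℤ _ _ hd

end Dual

/-! ### Fractional ideals, multiplicator rings and over-orders -/

section Basic

variable {R : Type*} [CommRing R]

theorem zsmul_injective_of_rat {V : Type*} [AddCommGroup V] [Module ℚ V] {n : ℤ} (hn : n ≠ 0) :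
    Function.Injective fun x : V => n • x := by
  have hn' : (n : ℚ) ≠ 0 := by exact_mod_cast hn
  intro x y h
  simp only [← Int.cast_smul_eq_zsmul ℚ] at h
  exact smul_right_injective V hn' h

theorem exists_int_smul_le {V : Type*} [AddCommGroup V] [Module R V] {M N : Submodule R V}
    (hM : M.FG) (hN : ∀ x : V, ∃ n : ℤ, n ≠ 0 ∧ n • x ∈ N) :
    ∃ n : ℤ, n ≠ 0 ∧ ∀ x ∈ M, n • x ∈ N := by
  induction M, hM using Submodule.fg_induction with
  | singleton x =>
    obtain ⟨n, hn, hx⟩ := hN x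
    refine ⟨n, hn, fun y hy => ?_⟩
    obtain ⟨r, rfl⟩ := Submodule.mem_span_singleton.1 hy
    rw [smul_comm]
    exact N.smul_mem r hx
  | sup M₁ M₂ _ _ h₁ h₂ =>
    obtain ⟨n, hn, h₁⟩ := h₁
    obtain ⟨m, hm, h₂⟩ := h₂
    refine ⟨m * n, mul_ne_zero hm hn, fun x hx => ?_⟩
    obtain ⟨y, hy, z, hz, rfl⟩ := Submodule.mem_sup.1 hx
    rw [smul_add]
    refine N.add_mem ?_ ?_
    · rw [mul_smul]; exact N.smul_of_tower_mem m (h₁ y hy)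
    · rw [mul_comm, mul_smul]; exact N.smul_of_tower_mem n (h₂ z hz)

variable {K V : Type*} [CommRing K] [Algebra R K] [AddCommGroup V] [Module R V] [Module K V]
  [IsScalarTower R K V]

/-- The multiplicator ring `{x ∈ K | x M ⊆ M}` of a lattice `M`. -/
def multSubalgebra (K : Type*) [CommRing K] [Algebra R K] [Module K V] [IsScalarTower R K V]
    (M : Submodule R V) : Subalgebra R K where
  carrier := {x | ∀ v ∈ M, x • v ∈ M}
  mul_mem' {a b} ha hb v hv := by rw [mul_smul]; exact ha _ (hb v hv)
  add_mem' {a b} ha hb v hv := by rw [add_smul]; exact M.add_mem (ha v hv) (hb v hv)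
  algebraMap_mem' r v hv := by rw [algebraMap_smul]; exact M.smul_mem r hv

theorem toSubmodule_multSubalgebra (I : Submodule R K) :
    Subalgebra.toSubmodule (multSubalgebra K I) = I / I := by
  ext x
  exact Submodule.mem_div_iff_forall_mul_mem.symm

theorem one_mem_div_self (I : Submodule R K) : (1 : K) ∈ I / I :=
  Submodule.mem_div_iff_forall_mul_mem.2 fun y hy => by rwa [one_mul]

theorem mul_mem_div_self {I : Submodule R K} {x y : K} (hx : x ∈ I / I) (hy : y ∈ I / I) :
    x * y ∈ I / I := by
  rw [← toSubmodule_multSubalgebra, Subalgebra.mem_toSubmodule] at *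
  exact mul_mem hx hy

end Basic

section Orders

variable {R K : Type*} [CommRing R] [CommRing K] [Algebra R K]

variable [Algebra ℚ K] [Module.Finite ℤ R]

theorem fg_of_zsmul_le {V : Type*} [AddCommGroup V] [Module R V] [Module ℚ V]
    {M N : Submodule R V} (hN : N.FG) {n : ℤ} (hn : n ≠ 0)
    (h : ∀ x ∈ M, n • x ∈ N) : M.FG := by
  have : IsNoetherianRing R := IsNoetherianRing.of_finite ℤ R
  have : IsNoetherian R N := isNoetherian_of_fg_of_noetherian N hN
  let g : V →ₗ[R] V := n • LinearMap.id
  have hg : Function.Injective g := zsmul_injective_of_rat hn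
  refine Submodule.fg_of_fg_map_injective g hg ?_
  have hle : M.map g ≤ N := by
    rintro _ ⟨x, hx, rfl⟩
    exact h x hx
  have := isNoetherian_of_le hle
  exact Module.Finite.iff_fg.1 inferInstance

theorem _root_.IsFracIdeal.div {I J : Submodule R K} (hI : IsFracIdeal R K I)
    (hJ : IsFracIdeal R K J) :
    IsFracIdeal R K (I / J) := by
  obtain ⟨n, hn, h1⟩ := hJ.full 1
  refine ⟨fg_of_zsmul_le hI.fg hn fun x hx => ?_, fun x => ?_⟩
  · have := Submodule.mem_div_iff_forall_mul_mem.1 hx _ h1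
    rwa [mul_smul_comm, mul_one] at this
  · obtain ⟨d, hd, h⟩ := exists_int_smul_le (hJ.fg.map (LinearMap.mulLeft R x)) hI.full
    refine ⟨d, hd, Submodule.mem_div_iff_forall_mul_mem.2 fun y hy => ?_⟩
    rw [smul_mul_assoc]
    exact h _ ⟨y, hy, rfl⟩

omit [Algebra ℚ K] [Module.Finite ℤ R] in
/-- Reflexivity over a Gorenstein over-order `S`, restated for `R`-submodules of `K`. -/
theorem _root_.IsGorensteinOrder.div_div {S : Subalgebra R K} (hS : IsGorensteinOrder S K)
    {I : Submodule R K} (hI : IsFracIdeal R K I) (hSI : ∀ s ∈ S, ∀ x ∈ I, s * x ∈ I) :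
    Subalgebra.toSubmodule S / (Subalgebra.toSubmodule S / I) = I := by
  let I' : Submodule S K :=
    { I with smul_mem' := fun s x hx => hSI s s.2 x hx }
  have hI' : IsFracIdeal S K I' := by
    refine ⟨Submodule.FG.of_restrictScalars R ?_, hI.full⟩
    convert! hI.fg
  have h := hS I' hI'
  have h1 : ∀ x : K, x ∈ (1 : Submodule S K) ↔ x ∈ S := fun x => by
    rw [Submodule.mem_one]
    exact ⟨fun ⟨y, hy⟩ => hy ▸ y.2, fun hx => ⟨⟨x, hx⟩, rfl⟩⟩
  ext x
  have hx := SetLike.ext_iff.1 h x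
  simp only [Submodule.mem_div_iff_forall_mul_mem, h1] at hx
  simp only [Submodule.mem_div_iff_forall_mul_mem, Subalgebra.mem_toSubmodule]
  exact hx

/-- Over a Bass order every fractional ideal `I` is invertible over its multiplicator ring
`S = (I : I)`. With `A = I (S : I)` one has `(S : A) = ((S : (S : I)) : I) = (I : I) = S`, hence
`A = (S : (S : A)) = (S : S) = S`. -/
theorem _root_.IsBassOrder.mul_div_cancel (hB : IsBassOrder R K) {I : Submodule R K}
    (hI : IsFracIdeal R K I) :
    I * ((I / I) / I) = I / I := by
  set S := multSubalgebra K I with hSdef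
  have hS : Subalgebra.toSubmodule S = I / I := toSubmodule_multSubalgebra I
  have hSf : IsFracIdeal R K (Subalgebra.toSubmodule S) := hS ▸ hI.div hI
  have hG := hB S hSf
  rw [← hS]
  set A := I * (Subalgebra.toSubmodule S / I)
  have hA : IsFracIdeal R K A := hI.mul (hSf.div hI)
  have hSA : ∀ s ∈ S, ∀ x ∈ A, s * x ∈ A := fun s hs x hx => by
    induction hx using Submodule.mul_induction_on' with
    | mem_mul_mem m hm n hn =>
      rw [← mul_assoc]
      exact Submodule.mul_mem_mul (hs m hm) hn
    | add a _ b _ ha hb => rw [mul_add]; exact A.add_mem ha hb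
  have hSI := hG.div_div hI fun s hs x hx => hs x hx
  have hdiv : Subalgebra.toSubmodule S / A = Subalgebra.toSubmodule S := by
    refine le_antisymm (fun x hx => ?_) (fun x hx => ?_)
    · rw [Submodule.mem_div_iff_forall_mul_mem] at hx
      refine fun v hv => ?_
      change x • v ∈ I
      rw [← hSI, Submodule.mem_div_iff_forall_mul_mem]
      intro y hy
      rw [smul_eq_mul, mul_assoc]
      exact hx _ (Submodule.mul_mem_mul hv hy)
    · rw [Submodule.mem_div_iff_forall_mul_mem]
      intro y hy
      have hle : A ≤ Subalgebra.toSubmodule S := Submodule.mul_le.2 fun m hm n hn => by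
        rw [mul_comm]; exact Submodule.mem_div_iff_forall_mul_mem.1 hn m hm
      exact S.mul_mem hx (hle hy)
  have := hG.div_div hA hSA
  rw [hdiv] at this
  rw [← this]
  ext x
  rw [Submodule.mem_div_iff_forall_mul_mem]
  exact ⟨fun h => by simpa using h 1 S.one_mem, fun hx y hy => S.mul_mem hx hy⟩

variable [FiniteDimensional ℚ K] [IsReduced K]

omit [FiniteDimensional ℚ K] [IsReduced K] in
theorem exists_int_eq_trace {I : Submodule R K} (hI : IsFracIdeal R K I) {x : K}
    (hx : x ∈ I / I) : ∃ n : ℤ, Algebra.trace ℚ K x = n := by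
  obtain ⟨n, b, hb⟩ := (isFullLattice_iff.2 hI).exists_basis
  rw [Algebra.trace_apply, LinearMap.trace_eq_matrix_trace ℚ b, Matrix.trace]
  have : ∀ i, ∃ k : ℤ, (k : ℚ) = (LinearMap.toMatrix b b (Algebra.lmul ℚ K x)).diag i := by
    intro i
    rw [Matrix.diag_apply, LinearMap.toMatrix_apply]
    have hmem : x * b i ∈ Submodule.span ℤ (Set.range b) := by
      rw [hb]
      have hbi : b i ∈ Submodule.span ℤ (Set.range b) := Submodule.subset_span ⟨i, rfl⟩
      rw [hb] at hbi
      exact Submodule.mem_div_iff_forall_mul_mem.1 hx _ hbi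
    exact (b.mem_span_iff_repr_mem ℤ _).1 hmem i
  choose k hk using this
  exact ⟨∑ i, k i, by rw [← Finset.sum_congr rfl fun i _ => hk i]; push_cast; rfl⟩

omit [Algebra ℚ K] [FiniteDimensional ℚ K] [IsReduced K] in
theorem mul_nondegenerate (v : K) (h : ∀ w, LinearMap.mul K K v w = 0) : v = 0 := by
  simpa using h 1

/-- The over-orders of `R` have bounded denominators: they all lie in the trace dual of `R`. -/
theorem exists_int_smul_div_self_le_one (h1 : IsFracIdeal R K (1 : Submodule R K)) :
    ∃ d : ℤ, d ≠ 0 ∧ ∀ I : Submodule R K, IsFracIdeal R K I → ∀ x ∈ I / I,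
      d • x ∈ (1 : Submodule R K) := by
  have hD := (isFullLattice_iff.2 h1).traceDual (β := LinearMap.mul K K)
    (fun v w => by simp [mul_comm]) mul_nondegenerate
  obtain ⟨d, hd, h⟩ := exists_int_smul_le hD.fg h1.full
  refine ⟨d, hd, fun I hI x hx => h x (mem_traceDual.2 fun w hw => ?_)⟩
  obtain ⟨r, rfl⟩ := Submodule.mem_one.1 hw
  refine exists_int_eq_trace hI ?_
  rw [LinearMap.mul_apply', mul_comm, ← Algebra.smul_def]
  exact Submodule.smul_mem _ r hx

end Orders

/-! ### Pairings modulo an integer -/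

section Semilocal

theorem finite_maximal_ideals_containing_int {S : Type*} [CommRing S] [Module.Finite ℤ S] {m : ℤ}
    (hm : m ≠ 0) : Finite {P : Ideal S // P.IsMaximal ∧ (m : S) ∈ P} := by
  let Q := S ⧸ Ideal.span {(m : S)}
  have : Module.Finite ℤ Q := Module.Finite.of_surjective
    ((Ideal.Quotient.mkₐ ℤ (Ideal.span {(m : S)})).toLinearMap) Ideal.Quotient.mk_surjective
  have : Finite Q := by
    refine Module.finite_of_fg_torsion Q fun {x} => ⟨⟨m, mem_nonZeroDivisors_of_ne_zero hm⟩, ?_⟩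
    obtain ⟨y, rfl⟩ := Ideal.Quotient.mk_surjective x
    change m • Ideal.Quotient.mk (Ideal.span {(m : S)}) y = 0
    rw [← map_zsmul, Ideal.Quotient.eq_zero_iff_mem, zsmul_eq_mul]
    exact Ideal.mul_mem_right _ _ (Ideal.mem_span_singleton_self _)
  have : Finite (Ideal Q) := Finite.of_injective _ (SetLike.coe_injective (A := Ideal Q))
  refine Finite.of_injective
    (fun P : {P : Ideal S // P.IsMaximal ∧ (m : S) ∈ P} =>
      P.1.map (Ideal.Quotient.mk (Ideal.span {(m : S)}))) fun P P' h => Subtype.ext ?_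
  have key : ∀ P : {P : Ideal S // P.IsMaximal ∧ (m : S) ∈ P},
      (P.1.map (Ideal.Quotient.mk (Ideal.span {(m : S)}))).comap (Ideal.Quotient.mk _) = P.1 :=
    fun P => by
      rw [Ideal.comap_map_of_surjective _ Ideal.Quotient.mk_surjective,
        ← RingHom.ker_eq_comap_bot, Ideal.mk_ker, sup_eq_left, Ideal.span_singleton_le_iff_mem]
      exact P.2.2
  rw [← key P, ← key P']
  exact congrArg _ h

variable {R K V : Type*} [CommRing R] [CommRing K] [Algebra R K]
  [AddCommGroup V] [Module R V] [Module K V] [IsScalarTower R K V]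

omit [IsScalarTower R K V] in
/-- If the values of a pairing of two `S`-lattices generate `S`, then the pairing takes a value
congruent to `1` modulo any nonzero integer `m`: the ring `S / m` has finitely many maximal
ideals, so vectors that work at each of them can be glued by the Chinese remainder theorem. -/
theorem exists_pairing_sub_one_mem (S : Subalgebra R K) [Module.Finite ℤ S] {m : ℤ}
    (hm : m ≠ 0) (β : V →ₗ[K] V →ₗ[K] K) {M L : Submodule R V}
    (hM : ∀ s ∈ S, ∀ v ∈ M, s • v ∈ M) (hL : ∀ s ∈ S, ∀ v ∈ L, s • v ∈ L)
    (hβ : ∀ v ∈ M, ∀ w ∈ L, β v w ∈ S)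
    (h1 : (1 : K) ∈ Submodule.span R {x | ∃ v ∈ M, ∃ w ∈ L, β v w = x}) :
    ∃ v ∈ M, ∃ w ∈ L, ∃ s ∈ S, β v w - 1 = m • s := by
  classical
  let F := {P : Ideal S // P.IsMaximal ∧ (m : S) ∈ P}
  have : Finite F := finite_maximal_ideals_containing_int hm
  cases nonempty_fintype F
  have hex : ∀ P : F, ∃ v : M, ∃ w : L, (⟨β v w, hβ _ v.2 _ w.2⟩ : S) ∉ P.1 := by
    intro P
    by_contra! hcon
    have hle : Submodule.span R {x | ∃ v ∈ M, ∃ w ∈ L, β v w = x} ≤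
        (P.1.restrictScalars R).map S.val.toLinearMap := by
      rw [Submodule.span_le]
      rintro _ ⟨v, hv, w, hw, rfl⟩
      exact ⟨_, hcon ⟨v, hv⟩ ⟨w, hw⟩, rfl⟩
    obtain ⟨y, hy, hy1⟩ := hle h1
    have : y = 1 := Subtype.ext hy1
    exact P.2.1.ne_top ((Ideal.eq_top_iff_one _).2 (this ▸ hy))
  choose v w hvw using hex
  have hcop : Pairwise (Function.onFun IsCoprime fun P : F => P.1) := fun P P' h =>
    Ideal.isCoprime_iff_sup_eq.2 (P.2.1.coprime_of_ne P'.2.1 fun h' => h (Subtype.ext h'))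
  choose e he using fun P : F =>
    Ideal.exists_forall_sub_mem_ideal hcop (Pi.single P (1 : S))
  let b : F → F → S := fun P Q => ⟨β (v P) (w Q), hβ _ (v P).2 _ (w Q).2⟩
  let x : S := ∑ P, ∑ Q, e P * e Q * b P Q
  have hx : ∀ P : F, x ∉ P.1 := by
    intro P hP
    have hmk : ∀ Q, Ideal.Quotient.mk P.1 (e Q) = if Q = P then 1 else 0 := fun Q => by
      rw [Ideal.Quotient.eq.2 (he Q P), Pi.single_apply]
      split_ifs with h1 h2 h2
      · simp
      · exact absurd h1.symm h2
      · exact absurd h2.symm h1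
      · simp
    have : Ideal.Quotient.mk P.1 x = Ideal.Quotient.mk P.1 (b P P) := by
      simp only [x, map_sum, map_mul, hmk, ite_mul, mul_ite, one_mul, mul_one, zero_mul, mul_zero]
      rw [Finset.sum_eq_single P (by simp +contextual) (by simp),
        Finset.sum_eq_single P (by simp +contextual) (by simp), if_pos rfl, if_pos rfl]
    rw [Ideal.Quotient.eq_zero_iff_mem.2 hP] at this
    exact hvw P (Ideal.Quotient.eq_zero_iff_mem.1 this.symm)
  have htop : Ideal.span {x, (m : S)} = ⊤ := by
    by_contra hne
    obtain ⟨P, hP, hle⟩ := Ideal.exists_le_maximal _ hne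
    exact hx ⟨P, hP, hle (Ideal.subset_span (by simp))⟩ (hle (Ideal.subset_span (by simp)))
  obtain ⟨a, c, hac⟩ := Ideal.mem_span_pair.1 ((Ideal.eq_top_iff_one _).1 htop)
  refine ⟨(a : K) • ∑ P, (e P : K) • (v P : V), hM _ a.2 _ (Submodule.sum_mem _ fun P _ =>
    hM _ (e P).2 _ (v P).2), ∑ P, (e P : K) • (w P : V), Submodule.sum_mem _ fun P _ =>
    hL _ (e P).2 _ (w P).2, -c, neg_mem c.2, ?_⟩
  have hxK : β (∑ P, (e P : K) • (v P : V)) (∑ P, (e P : K) • (w P : V)) = (x : K) := by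
    simp only [map_sum, LinearMap.sum_apply, map_smul, LinearMap.smul_apply, smul_eq_mul, x, b]
    push_cast
    rw [Finset.sum_comm]
    refine Finset.sum_congr rfl fun P _ => ?_
    rw [Finset.mul_sum]
    refine Finset.sum_congr rfl fun Q _ => ?_
    ring
  have hacK := congrArg (Subtype.val : S → K) hac
  push_cast at hacK
  rw [map_smul, LinearMap.smul_apply, hxK, smul_eq_mul, ← hacK, zsmul_eq_mul]
  ring

end Semilocal

/-! ### Rearranging sums of invertible ideals -/

section TwoIdeals

variable {R K : Type*} [CommRing R] [CommRing K] [Algebra R K]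

/-- If `a y + c z = 1` with `a ∈ I`, `y ∈ (S : I)`, `c ∈ J`, `z ∈ (S : J)`, where `S` is a ring and
`I`, `J` are `S`-modules, then `I ⊕ J ≃ S ⊕ IJ` by the matrix with rows `(y, z)`, `(c, -a)`. -/
noncomputable def prodEquivOfMulAddMul {S I J : Submodule R K} {a c y z : K}
    (haI : ∀ s ∈ S, s * a ∈ I) (hcJ : ∀ s ∈ S, s * c ∈ J) (ha : a ∈ I) (hc : c ∈ J)
    (hy : ∀ i ∈ I, i * y ∈ S) (hz : ∀ j ∈ J, j * z ∈ S)
    (hyJ : ∀ k ∈ I * J, k * y ∈ J) (hzI : ∀ k ∈ I * J, k * z ∈ I)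
    (h : a * y + c * z = 1) :
    (I × J) ≃ₗ[R] (S × (I * J : Submodule R K)) where
  toFun p := (⟨p.1 * y + p.2 * z, S.add_mem (hy _ p.1.2) (hz _ p.2.2)⟩,
    ⟨p.1 * c - a * p.2, sub_mem (Submodule.mul_mem_mul p.1.2 hc) (Submodule.mul_mem_mul ha p.2.2)⟩)
  invFun q := (⟨q.1 * a + q.2 * z, I.add_mem (haI _ q.1.2) (hzI _ q.2.2)⟩,
    ⟨q.1 * c - q.2 * y, J.sub_mem (hcJ _ q.1.2) (hyJ _ q.2.2)⟩)
  map_add' p q := by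
    ext <;> simp <;> ring
  map_smul' r p := by
    ext <;> simp [Algebra.smul_def] <;> ring
  left_inv p := by
    ext
    · simp only
      linear_combination (p.1 : K) * h
    · simp only
      linear_combination (p.2 : K) * h
  right_inv q := by
    ext
    · simp only
      linear_combination (q.1 : K) * h
    · simp only
      linear_combination (q.2 : K) * h

variable [Algebra ℚ K] [Module.Finite ℤ R]

omit [Algebra ℚ K] in
theorem moduleFinite_int_of_fg {S : Subalgebra R K} (h : (Subalgebra.toSubmodule S).FG) :
    Module.Finite ℤ S := by
  have : Module.Finite R S := Module.Finite.iff_fg.2 h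
  exact Module.Finite.trans R S

/-- If `I` is invertible over `S = (I : I)` and `S J ⊆ J`, then `I ⊕ J ≃ S ⊕ IJ`. -/
theorem nonempty_prod_equiv {I J : Submodule R K} (hI : IsFracIdeal R K I)
    (hJ : IsFracIdeal R K J) (hinv : I * ((I / I) / I) = I / I)
    (hSJ : I / I ≤ J / J) :
    Nonempty ((I × J) ≃ₗ[R] ((I / I : Submodule R K) × (I * J : Submodule R K))) := by
  set S := multSubalgebra K I
  have hS : Subalgebra.toSubmodule S = I / I := toSubmodule_multSubalgebra I
  have hSf := hI.div hI
  have : Module.Finite ℤ S := moduleFinite_int_of_fg (hS ▸ hSf.fg)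
  have memS : ∀ x, x ∈ S ↔ x ∈ I / I := fun x => by rw [← hS]; rfl
  obtain ⟨n, hn, hnJ⟩ := exists_int_smul_le hJ.fg hSf.full
  obtain ⟨k, hk, hk1⟩ := hJ.full 1
  -- an element congruent to `1` modulo `n k` differs from `1` by an element of `n J`
  obtain ⟨a, ha, y, hy, s, hs, hay⟩ := exists_pairing_sub_one_mem S (mul_ne_zero hn hk)
    (LinearMap.mul K K) (M := I) (L := (I / I) / I) (fun s hs v hv => hs v hv)
    (fun s hs v hv => by
      rw [Submodule.mem_div_iff_forall_mul_mem] at hv ⊢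
      intro i hi
      rw [smul_eq_mul, mul_assoc]
      exact mul_mem_div_self ((memS s).1 hs) (hv i hi))
    (fun v hv w hw => by
      rw [memS, LinearMap.mul_apply', mul_comm]
      exact Submodule.mem_div_iff_forall_mul_mem.1 hw v hv)
    (by
      have h1 := one_mem_div_self I
      rw [← hinv] at h1
      refine Submodule.mul_le.2 (fun m hm n hn => ?_) h1
      exact Submodule.subset_span ⟨m, hm, n, hn, rfl⟩)
  have hsmulJ : ∀ s ∈ I / I, ∀ j ∈ J, s * j ∈ J := fun s hs j hj =>
    Submodule.mem_div_iff_forall_mul_mem.1 (hSJ hs) j hj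
  have hsmulI : ∀ s ∈ I / I, ∀ j ∈ I, s * j ∈ I := fun s hs j hj =>
    Submodule.mem_div_iff_forall_mul_mem.1 hs j hj
  rw [Submodule.mem_div_iff_forall_mul_mem] at hy
  have hc : -(k • s) ∈ J := by
    have := hsmulJ s ((memS s).1 hs) _ hk1
    rw [mul_smul_comm, mul_one] at this
    exact J.neg_mem this
  refine ⟨prodEquivOfMulAddMul (a := a) (c := -(k • s)) (y := y) (z := (n : K))
    (fun s hs => hsmulI s hs a ha) (fun s hs => hsmulJ s hs _ hc) ha hc
    (fun i hi => by rw [mul_comm]; exact hy i hi)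
    (fun j hj => by rw [mul_comm, ← zsmul_eq_mul]; exact hnJ j hj)
    (fun x hx => ?_) (fun x hx => ?_) ?_⟩
  · refine Submodule.mul_induction_on hx (fun i hi j hj => ?_) fun u v hu hv => ?_
    · have := hsmulJ _ (hy i hi) j hj
      rwa [show i * j * y = y * i * j by ring]
    · rw [add_mul]; exact J.add_mem hu hv
  · refine Submodule.mul_induction_on hx (fun i hi j hj => ?_) fun u v hu hv => ?_
    · have := hsmulI _ (hnJ j hj) i hi
      rw [zsmul_eq_mul] at this
      rwa [show i * j * n = n * j * i by ring]
    · rw [add_mul]; exact I.add_mem hu hv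
  · rw [LinearMap.mul_apply'] at hay
    simp only [zsmul_eq_mul] at hay ⊢
    push_cast at hay
    linear_combination hay

end TwoIdeals

/-! ### Splitting off an invertible ideal -/

section Splitting

variable {R K V : Type*} [CommRing R] [CommRing K] [Algebra R K] [Algebra ℚ K]
  [AddCommGroup V] [Module R V] [Module K V] [Module ℚ V] [IsScalarTower R K V]
  [IsScalarTower ℚ K V] [FiniteDimensional ℚ K] [IsReduced K] [Module.Finite ℤ R]

omit [Algebra ℚ K] [Module ℚ V] [IsScalarTower ℚ K V] [FiniteDimensional ℚ K] [IsReduced K]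
  [Module.Finite ℤ R] in
theorem span_pairing_fg (β : V →ₗ[K] V →ₗ[K] K) {M L : Submodule R V} (hM : M.FG) (hL : L.FG) :
    (Submodule.span R {x | ∃ v ∈ M, ∃ w ∈ L, β v w = x}).FG := by
  have h := hM.map₂ (β.restrictScalars₁₂ R R) hL
  rw [Submodule.map₂_eq_span_image2] at h
  exact h

/-- The product `M M†` of a lattice with its trace dual, taken with respect to `β`, is the trace
dual of the multiplicator ring of `M`: both have trace dual `{x | x M ⊆ M†† = M}`. -/
theorem traceDual_span_pairing {β : V →ₗ[K] V →ₗ[K] K} (hsymm : ∀ v w, β v w = β w v)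
    (hβ : ∀ v, (∀ w, β v w = 0) → v = 0) {M : Submodule R V} (hM : IsFullLattice R M) :
    traceDual (LinearMap.mul K K)
      (Submodule.span R {x | ∃ v ∈ M, ∃ w ∈ traceDual β M, β v w = x}) =
      Subalgebra.toSubmodule (multSubalgebra K M) := by
  refine le_antisymm (fun x hx v hv => ?_) (fun s hs => ?_)
  · rw [← hM.traceDual_traceDual hsymm hβ, mem_traceDual]
    intro w hw
    rw [map_smul, LinearMap.smul_apply]
    exact mem_traceDual.1 hx _ (Submodule.subset_span ⟨v, hv, w, hw, rfl⟩)
  · rw [mem_traceDual]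
    have hle : Submodule.span R {x | ∃ v ∈ M, ∃ w ∈ traceDual β M, β v w = x} ≤
        traceDual (LinearMap.mul K K) (Subalgebra.toSubmodule (multSubalgebra K M)) := by
      rw [Submodule.span_le]
      rintro _ ⟨v, hv, w, hw, rfl⟩
      refine mem_traceDual.2 fun t ht => ?_
      have := mem_traceDual.1 hw _ (ht v hv)
      rwa [map_smul, smul_eq_mul, hsymm w v, mul_comm] at this
    intro a ha
    rw [LinearMap.mul_apply', mul_comm]
    exact mem_traceDual.1 (hle ha) s hs

/-- Over a Bass order the multiplicator ring `S` of a lattice `M` is the trace ideal of `M`: the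
`S`-linear functionals `β · w` on `M` have values generating `S`. -/
theorem one_mem_span_pairing (hB : IsBassOrder R K)
    {β : V →ₗ[K] V →ₗ[K] K} (hsymm : ∀ v w, β v w = β w v)
    (hβ : ∀ v, (∀ w, β v w = 0) → v = 0) (hone : ∃ v w, β v w = 1)
    {M : Submodule R V} (hM : IsFullLattice R M) :
    IsFracIdeal R K (Subalgebra.toSubmodule (multSubalgebra K M)) ∧
    (1 : K) ∈ Submodule.span R {x | ∃ v ∈ M, ∃ w ∈ {w : V | ∀ v ∈ M, β v w ∈ multSubalgebra K M},
      β v w = x} := by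
  set S := multSubalgebra K M
  set A := Submodule.span R {x | ∃ v ∈ M, ∃ w ∈ traceDual β M, β v w = x} with hA
  have hD := hM.traceDual hsymm hβ
  have hsm : ∀ v w : K, LinearMap.mul K K v w = LinearMap.mul K K w v := fun v w => by
    simp [mul_comm]
  have hAl : IsFullLattice R A := by
    refine ⟨span_pairing_fg β hM.fg hD.fg, fun x => ?_⟩
    obtain ⟨v, w, hvw⟩ := hone
    obtain ⟨n, hn, hv⟩ := hM.full (x • v)
    obtain ⟨k, hk, hw⟩ := hD.full w
    refine ⟨k * n, mul_ne_zero hk hn, Submodule.subset_span ⟨_, hv, _, hw, ?_⟩⟩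
    rw [map_zsmul, map_zsmul, LinearMap.smul_apply, map_smul, LinearMap.smul_apply, hvw,
      smul_eq_mul, mul_one, smul_smul]
  have hAS : traceDual (LinearMap.mul K K) A = Subalgebra.toSubmodule S :=
    traceDual_span_pairing hsymm hβ hM
  have hSf : IsFracIdeal R K (Subalgebra.toSubmodule S) := by
    rw [← isFullLattice_iff, ← hAS]
    exact hAl.traceDual hsm mul_nondegenerate
  have hSA : traceDual (LinearMap.mul K K) (Subalgebra.toSubmodule S) = A := by
    rw [← hAS]
    exact hAl.traceDual_traceDual hsm mul_nondegenerate
  have hAA : A / A = Subalgebra.toSubmodule S := by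
    refine le_antisymm (fun x hx => ?_) (fun s hs => ?_)
    · rw [← hAS, mem_traceDual]
      intro a ha
      have := Submodule.mem_div_iff_forall_mul_mem.1 hx a ha
      rw [← hSA, mem_traceDual] at this
      simpa using this 1 S.one_mem
    · rw [Submodule.mem_div_iff_forall_mul_mem]
      have hle : A ≤ A.comap (LinearMap.mulLeft R s) := by
        rw [hA, Submodule.span_le]
        rintro _ ⟨v, hv, w, hw, rfl⟩
        refine Submodule.subset_span ⟨s • v, hs v hv, w, hw, ?_⟩
        simp
      exact fun a ha => hle ha
  refine ⟨hSf, ?_⟩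
  have h1 : (1 : K) ∈ A * ((A / A) / A) := by
    rw [hB.mul_div_cancel (isFullLattice_iff.1 hAl)]
    exact one_mem_div_self A
  refine Submodule.mul_le.2 (fun a ha y hy => ?_) h1
  rw [hAA, Submodule.mem_div_iff_forall_mul_mem] at hy
  set T := Submodule.span R
    {x | ∃ v ∈ M, ∃ w ∈ {w : V | ∀ v ∈ M, β v w ∈ multSubalgebra K M}, β v w = x}
  have hle : A ≤ T.comap (LinearMap.mulRight R y) := by
    rw [hA, Submodule.span_le]
    rintro _ ⟨v, hv, w, hw, rfl⟩
    refine Submodule.subset_span ⟨v, hv, y • w, fun v' hv' => ?_, ?_⟩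
    · rw [map_smul, smul_eq_mul]
      exact hy _ (Submodule.subset_span ⟨v', hv', w, hw, rfl⟩)
    · rw [map_smul, smul_eq_mul, mul_comm]; rfl
  exact hle ha

omit [Algebra ℚ K] [FiniteDimensional ℚ K] [IsReduced K] [Module.Finite ℤ R] in
/-- Let `I ⊆ S` be an `S`-submodule with `I + m S = S` for an integer `m ≠ ±1`. Then `I` contains a
nonzero integer, by Nakayama's lemma for the `ℤ`-module `S / I`. -/
theorem exists_int_mem_of_add_smul_eq_one {S : Subalgebra R K} [Module.Finite ℤ S]
    {I : Submodule R K} (hSI : ∀ s ∈ S, ∀ x ∈ I, s * x ∈ I) {m : ℤ} (hm : ¬ IsUnit m) {i s : K}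
    (hi : i ∈ I) (hs : s ∈ S) (h : i - 1 = m • s) : ∃ r : ℤ, r ≠ 0 ∧ (r : K) ∈ I := by
  let I' : Submodule ℤ S := (I.comap S.val.toLinearMap).restrictScalars ℤ
  have hle : (⊤ : Submodule ℤ (S ⧸ I')) ≤ Ideal.span {m} • (⊤ : Submodule ℤ (S ⧸ I')) := by
    rintro x -
    obtain ⟨y, rfl⟩ := I'.mkQ_surjective x
    have : I'.mkQ y = m • I'.mkQ (-⟨s, hs⟩ * y) := by
      rw [← map_zsmul, ← sub_eq_zero, ← map_sub, ← LinearMap.mem_ker, Submodule.ker_mkQ]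
      change (y : K) - ((m • (-⟨s, hs⟩ * y) : S) : K) ∈ I
      have : (y : K) - ((m • (-⟨s, hs⟩ * y) : S) : K) = y * i := by
        rw [zsmul_eq_mul] at h
        rw [zsmul_eq_mul]
        push_cast
        linear_combination (-(y : K)) * h
      rw [this]
      exact hSI _ y.2 _ hi
    rw [this]
    exact Submodule.smul_mem_smul (Ideal.mem_span_singleton_self m) trivial
  obtain ⟨r, hr1, hr⟩ := Submodule.exists_sub_one_mem_and_smul_eq_zero_of_fg_of_le_smul
    (Ideal.span {m}) ⊤ (Module.Finite.fg_top (R := ℤ) (M := S ⧸ I')) hle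
  refine ⟨r, ?_, ?_⟩
  · rintro rfl
    rw [Ideal.mem_span_singleton, zero_sub, dvd_neg] at hr1
    exact hm (isUnit_of_dvd_one hr1)
  · have := hr (I'.mkQ 1) trivial
    rw [← map_zsmul, ← LinearMap.mem_ker, Submodule.ker_mkQ] at this
    change ((r • (1 : S) : S) : K) ∈ I at this
    simpa using this

/-- Over a Bass order, every lattice `M` of positive rank splits as `I ⊕ (M ∩ ker φ)`, where `I` is
a fractional ideal with the same multiplicator ring as `M` and `φ` a surjective functional. -/
theorem exists_splitting (h1 : IsFracIdeal R K (1 : Submodule R K)) (hB : IsBassOrder R K)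
    {β : V →ₗ[K] V →ₗ[K] K} (hsymm : ∀ v w, β v w = β w v)
    (hβ : ∀ v, (∀ w, β v w = 0) → v = 0) (hone : ∃ v w, β v w = 1)
    {M : Submodule R V} (hM : IsFullLattice R M) :
    ∃ (φ : V →ₗ[K] K) (I : Submodule R K), IsFracIdeal R K I ∧
      Subalgebra.toSubmodule (multSubalgebra K M) = I / I ∧ Function.Surjective φ ∧
      Nonempty (M ≃ₗ[R] I × (M ⊓ (LinearMap.ker φ).restrictScalars R : Submodule R V)) := by
  obtain ⟨hSf, hspan⟩ := one_mem_span_pairing hB hsymm hβ hone hM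
  set S := multSubalgebra K M
  have : Module.Finite ℤ S := moduleFinite_int_of_fg hSf.fg
  let L : Submodule R V :=
    { carrier := {w : V | ∀ v ∈ M, β v w ∈ S}
      add_mem' := fun ha hb v hv => by rw [map_add]; exact S.add_mem (ha v hv) (hb v hv)
      zero_mem' := fun v _ => by rw [map_zero]; exact S.zero_mem
      smul_mem' := fun r w hw v hv => by
        rw [← algebraMap_smul K r w, map_smul, algebraMap_smul]
        exact S.smul_mem (hw v hv) r }
  obtain ⟨d, hd, hdS⟩ := exists_int_smul_div_self_le_one h1
  -- `d` clears the denominators of all over-orders, and the factor `2` makes the modulus a nonunit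
  obtain ⟨v₀, hv₀, w₀, hw₀, s, hs, h₀⟩ := exists_pairing_sub_one_mem S (m := 2 * d)
    (mul_ne_zero two_ne_zero hd) β (M := M) (L := L) (fun s hs v hv => hs v hv)
    (fun s hs w hw v hv => by rw [map_smul]; exact S.mul_mem hs (hw v hv))
    (fun v hv w hw => hw v hv) hspan
  let φ : V →ₗ[K] K := β.flip w₀
  let I : Submodule R K := M.map (φ.restrictScalars R)
  have hIS : ∀ i ∈ I, i ∈ S := by
    rintro _ ⟨v, hv, rfl⟩
    exact hw₀ v hv
  have hSI : ∀ t ∈ S, ∀ i ∈ I, t * i ∈ I := by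
    rintro t ht _ ⟨v, hv, rfl⟩
    exact ⟨t • v, ht v hv, map_smul φ t v⟩
  have hi₀ : β v₀ w₀ ∈ I := ⟨v₀, hv₀, rfl⟩
  have hunit : ¬ IsUnit (2 * d) := fun h => by
    have := Int.isUnit_iff.1 h
    omega
  obtain ⟨r, hr, hrI⟩ := exists_int_mem_of_add_smul_eq_one hSI hunit hi₀ hs h₀
  have hI : IsFracIdeal R K I := by
    refine ⟨hM.fg.map _, fun x => ?_⟩
    obtain ⟨n, hn, hx⟩ := hSf.full x
    refine ⟨n * r, mul_ne_zero hn hr, ?_⟩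
    have := hSI _ hx _ hrI
    simp only [zsmul_eq_mul] at this ⊢
    rwa [show ((n * r : ℤ) : K) * x = n * x * r by push_cast; ring]
  have hII : Subalgebra.toSubmodule S = I / I := by
    refine le_antisymm (fun t ht => Submodule.mem_div_iff_forall_mul_mem.2 (hSI t ht))
      fun t ht => ?_
    have hdt : d • t ∈ S := by
      obtain ⟨r, hr⟩ := Submodule.mem_one.1 (hdS I hI t ht)
      rw [← hr]
      exact S.algebraMap_mem r
    have hti := hIS _ (Submodule.mem_div_iff_forall_mul_mem.1 ht _ hi₀)
    have : t = t * β v₀ w₀ - 2 * ((d • t) * s) := by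
      simp only [zsmul_eq_mul] at h₀ ⊢
      push_cast at h₀
      linear_combination (-t) * h₀
    change t ∈ S
    rw [this]
    exact S.sub_mem hti (S.mul_mem (by exact_mod_cast natCast_mem S 2) (S.mul_mem hdt hs))
  -- invertibility of `I` lifts `1` to a vector `u` with `φ u = 1` and `I u ⊆ M`
  have hlift : ∀ c ∈ I * ((I / I) / I), ∃ u : V, φ u = c ∧ ∀ i ∈ I, i • u ∈ M := by
    intro c hc
    induction hc using Submodule.mul_induction_on' with
    | mem_mul_mem a ha y hy =>
      obtain ⟨v, hv, rfl⟩ := ha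
      refine ⟨y • v, by rw [map_smul, smul_eq_mul, mul_comm]; rfl, fun i hi => ?_⟩
      rw [smul_smul, mul_comm]
      have := Submodule.mem_div_iff_forall_mul_mem.1 hy i hi
      rw [← hII] at this
      exact this v hv
    | add a _ b _ ha hb =>
      obtain ⟨u, hu, hu'⟩ := ha
      obtain ⟨w, hw, hw'⟩ := hb
      exact ⟨u + w, by rw [map_add, hu, hw], fun i hi => by
        rw [smul_add]; exact M.add_mem (hu' i hi) (hw' i hi)⟩
  obtain ⟨u, hu1, hu⟩ := hlift 1 (by rw [hB.mul_div_cancel hI]; exact one_mem_div_self I)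
  refine ⟨φ, I, hI, hII, fun x => ⟨x • u, by rw [map_smul, hu1, smul_eq_mul, mul_one]⟩, ⟨?_⟩⟩
  have hφr : ∀ (r : R) (v : V), φ (r • v) = r • φ v := fun r v => (φ.restrictScalars R).map_smul r v
  exact
    { toFun := fun v => (⟨φ v, v, v.2, rfl⟩, ⟨v - φ v • u, M.sub_mem v.2 (hu _ ⟨v, v.2, rfl⟩), by
        change φ _ = 0
        rw [map_sub, map_smul, hu1, smul_eq_mul, mul_one, sub_self]⟩)
      map_add' := fun v w => by
        ext
        · simp
        · simp only [Submodule.coe_add, map_add, add_smul, Prod.snd_add]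
          abel
      map_smul' := fun r v => by
        ext
        · simp [hφr]
        · simp [hφr, smul_sub]
      invFun := fun p => ⟨(p.1 : K) • u + p.2, M.add_mem (hu _ p.1.2) p.2.2.1⟩
      left_inv := fun v => by
        ext
        simp
      right_inv := fun p => by
        have hp : φ (p.2 : V) = 0 := p.2.2.2
        ext
        · simp [hu1, hp]
        · simp [hu1, hp] }

end Splitting

/-! ### Freeness from traces -/

section Free

open TensorProduct

variable {K V W : Type*} [CommRing K] [Algebra ℚ K]
  [AddCommGroup V] [Module K V] [Module ℚ V] [IsScalarTower ℚ K V]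
  [AddCommGroup W] [Module K W] [Module ℚ W] [IsScalarTower ℚ K W]

/-- The rational trace of multiplication by `x ∈ K` on a `K`-module `V`. -/
noncomputable def scalarTrace (V : Type*) [AddCommGroup V] [Module K V] [Module ℚ V]
    [IsScalarTower ℚ K V] (x : K) : ℚ :=
  LinearMap.trace ℚ V (Algebra.lsmul ℚ ℚ V x)

theorem scalarTrace_congr (e : V ≃ₗ[K] W) (x : K) : scalarTrace V x = scalarTrace W x := by
  rw [scalarTrace, scalarTrace, ← LinearMap.trace_conj' _ (e.restrictScalars ℚ)]
  congr 1
  ext w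
  simp [LinearEquiv.conj_apply]

theorem scalarTrace_prod [FiniteDimensional ℚ V] [FiniteDimensional ℚ W] (x : K) :
    scalarTrace (V × W) x = scalarTrace V x + scalarTrace W x := by
  rw [scalarTrace, scalarTrace, scalarTrace, ← LinearMap.trace_prodMap']
  rfl

theorem scalarTrace_pi [FiniteDimensional ℚ K] (N : ℕ) (x : K) :
    scalarTrace (Fin N → K) x = N * scalarTrace K x := by
  induction N with
  | zero =>
    rw [scalarTrace, show Algebra.lsmul ℚ ℚ (Fin 0 → K) x = 0 from LinearMap.ext fun v =>
      Subsingleton.elim _ _]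
    simp
  | succ N ih =>
    rw [← scalarTrace_congr (Fin.consLinearEquiv K fun _ : Fin (N + 1) => K) x, scalarTrace_prod]
    erw [ih]
    push_cast
    ring

theorem finrank_quotient_idempotent [FiniteDimensional ℚ V] {e : K} (he : IsIdempotentElem e) :
    (Module.finrank ℚ (V ⧸ (Ideal.span {e} • (⊤ : Submodule K V))) : ℚ) =
      scalarTrace V (1 : K) - scalarTrace V e := by
  have hid : IsIdempotentElem (Algebra.lsmul ℚ ℚ V e) := he.map _
  have h1 : scalarTrace V (1 : K) = Module.finrank ℚ V := by
    rw [scalarTrace, map_one]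
    exact LinearMap.trace_one (R := ℚ) (M := V)
  have h2 : scalarTrace V e =
      Module.finrank ℚ ((Ideal.span {e} • (⊤ : Submodule K V)).restrictScalars ℚ) := by
    have : LinearMap.range (Algebra.lsmul ℚ ℚ V e) =
        (Ideal.span {e} • (⊤ : Submodule K V)).restrictScalars ℚ := by
      ext v
      rw [Submodule.ideal_span_singleton_smul, Submodule.restrictScalars_mem,
        Submodule.mem_smul_pointwise_iff_exists]
      simp
    rw [← this]
    exact (LinearMap.IsIdempotentElem.isProj_range _ hid).trace
  have h3 := Submodule.finrank_quotient_add_finrank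
    ((Ideal.span {e} • (⊤ : Submodule K V)).restrictScalars ℚ)
  rw [h1, h2, ← h3]
  push_cast
  exact (add_sub_cancel_right _ _).symm

/-- A finite `K`-module on which every `x ∈ K` has `N` times its trace on `K` is free of rank `N`:
each maximal ideal `P` is generated by an idempotent, so the rank of `V / P V` over `K / P` can be
read off from traces. -/
theorem nonempty_equiv_pi_of_scalarTrace [FiniteDimensional ℚ K] [IsReduced K]
    [FiniteDimensional ℚ V] {N : ℕ}
    (h : ∀ x : K, scalarTrace V x = N * scalarTrace K x) : Nonempty (V ≃ₗ[K] (Fin N → K)) := by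
  have := isSemisimpleRing_of_reduced K
  have : IsArtinianRing K := IsArtinianRing.of_finite ℚ K
  have : Module.Finite K V := Module.Finite.of_restrictScalars_finite ℚ K V
  have : Module.Projective K V := Module.projective_of_isSemisimpleRing K V
  obtain ⟨b⟩ := Module.nonempty_basis_of_flat_of_finrank_eq K V N fun P => by
    have := P.2
    let := Ideal.Quotient.field P.1
    obtain ⟨e, he, hP⟩ := IsSemisimpleRing.ideal_eq_span_idempotent P.1
    have hV := finrank_quotient_idempotent (V := V) he
    have hK := finrank_quotient_idempotent (V := K) he
    rw [← hP] at hV hK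
    rw [smul_eq_mul, Ideal.mul_top] at hK
    have hT := ((quotTensorEquivQuotSMul V P.1).restrictScalars ℚ).finrank_eq
    have hmul := Module.finrank_mul_finrank ℚ (K ⧸ P.1) ((K ⧸ P.1) ⊗[K] V)
    have hpos : (Module.finrank ℚ (K ⧸ P.1) : ℚ) ≠ 0 := by
      exact_mod_cast (Module.finrank_pos (R := ℚ) (M := K ⧸ P.1)).ne'
    have : (Module.finrank ℚ (K ⧸ P.1) : ℚ) * Module.finrank (K ⧸ P.1) ((K ⧸ P.1) ⊗[K] V) =
        Module.finrank ℚ (K ⧸ P.1) * N := by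
      rw [← Nat.cast_mul, hmul, hT, hV, hK, h, h]
      ring
    exact_mod_cast mul_left_cancel₀ hpos this
  exact ⟨b.equivFun⟩

omit [Algebra ℚ K] [Module ℚ V] [IsScalarTower ℚ K V] in
/-- A surjective functional `φ` on `V` splits: `V ≃ K × ker φ`. -/
theorem nonempty_equiv_prod_ker (φ : V →ₗ[K] K) (hφ : Function.Surjective φ) :
    Nonempty (V ≃ₗ[K] K × LinearMap.ker φ) := by
  obtain ⟨u, hu⟩ := hφ 1
  exact ⟨{
    toFun := fun v => (φ v, ⟨v - φ v • u, by simp [hu]⟩)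
    map_add' := fun v w => by
      ext
      · simp
      · simp only [map_add, add_smul, Prod.snd_add, Submodule.coe_add]
        abel
    map_smul' := fun r v => by
      ext
      · simp
      · simp [smul_sub, mul_smul]
    invFun := fun p => p.1 • u + p.2
    left_inv := fun v => by simp
    right_inv := fun p => by ext <;> simp [hu] }⟩

theorem nonempty_ker_equiv_pi [FiniteDimensional ℚ K] [IsReduced K] {N : ℕ}
    (φ : (Fin (N + 1) → K) →ₗ[K] K) (hφ : Function.Surjective φ) :
    Nonempty (LinearMap.ker φ ≃ₗ[K] (Fin N → K)) := by
  obtain ⟨e⟩ := nonempty_equiv_prod_ker φ hφ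
  have : FiniteDimensional ℚ (LinearMap.ker φ) :=
    inferInstanceAs (FiniteDimensional ℚ ((LinearMap.ker φ).restrictScalars ℚ))
  refine nonempty_equiv_pi_of_scalarTrace fun x => ?_
  have h := scalarTrace_congr e x
  rw [scalarTrace_pi, scalarTrace_prod] at h
  push_cast at h
  linear_combination -h

end Free

/-! ### Lattices over Bass orders are sums of ideals -/

section Structure

variable {R K : Type*} [CommRing R] [CommRing K] [Algebra R K] [Algebra ℚ K]
  [FiniteDimensional ℚ K] [IsReduced K] [Module.Finite ℤ R]

/-- The standard bilinear form on `K ^ N`. -/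
def stdForm (K : Type*) [CommRing K] (N : ℕ) : (Fin N → K) →ₗ[K] (Fin N → K) →ₗ[K] K :=
  LinearMap.mk₂ K (fun v w => v ⬝ᵥ w) add_dotProduct smul_dotProduct dotProduct_add
    (fun c v w => dotProduct_smul c v w)

/-- Bass's structure theorem: a full lattice in `K ^ N` over a Bass order is a direct sum of
fractional ideals with increasing multiplicator rings. -/
theorem exists_chain_equiv (h1 : IsFracIdeal R K (1 : Submodule R K)) (hB : IsBassOrder R K)
    (N : ℕ) (M : Submodule R (Fin N → K)) (hM : IsFullLattice R M) :
    ∃ I : Fin N → FracIdeal R K, (Monotone fun i => (I i).multRing) ∧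
      (∀ i, Subalgebra.toSubmodule (multSubalgebra K M) ≤ (I i).multRing) ∧
      Nonempty (M ≃ₗ[R] ∀ i, (I i).1) := by
  induction N with
  | zero =>
    exact ⟨Fin.elim0, fun i => i.elim0, fun i => i.elim0,
      ⟨{ toFun := fun _ i => i.elim0, map_add' := fun _ _ => Subsingleton.elim _ _,
         map_smul' := fun _ _ => Subsingleton.elim _ _, invFun := fun _ => 0,
         left_inv := fun _ => Subsingleton.elim _ _,
         right_inv := fun _ => Subsingleton.elim _ _ }⟩⟩
  | succ N ih =>
    obtain ⟨φ, I₀, hI₀, hmult, hφ, ⟨e⟩⟩ := exists_splitting h1 hB (β := stdForm K (N + 1))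
      (fun v w => dotProduct_comm v w) (fun v hv => dotProduct_eq_zero v hv)
      ⟨Pi.single 0 1, Pi.single 0 1, by simp [stdForm]⟩ hM
    obtain ⟨ε⟩ := nonempty_ker_equiv_pi φ hφ
    let g : (LinearMap.ker φ) →ₗ[R] (Fin (N + 1) → K) :=
      (LinearMap.ker φ).subtype.restrictScalars R
    let M' : Submodule R (Fin N → K) := (M.comap g).map (ε.restrictScalars R).toLinearMap
    have hM' : IsFullLattice R M' := by
      refine ⟨Submodule.FG.map _ ?_, fun x => ?_⟩
      · have : IsNoetherianRing R := IsNoetherianRing.of_finite ℤ R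
        have : IsNoetherian R M := isNoetherian_of_fg_of_noetherian M hM.fg
        refine Submodule.fg_of_fg_map_injective g Subtype.val_injective ?_
        have hle : (M.comap g).map g ≤ M := Submodule.map_comap_le _ _
        have := isNoetherian_of_le hle
        exact Module.Finite.iff_fg.1 inferInstance
      · obtain ⟨n, hn, hx⟩ := hM.full (ε.symm x : LinearMap.ker φ)
        exact ⟨n, hn, n • ε.symm x, hx, by simp⟩
    have hS : Subalgebra.toSubmodule (multSubalgebra K M) ≤
        Subalgebra.toSubmodule (multSubalgebra K M') := by
      rintro s hs _ ⟨v, hv, rfl⟩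
      exact ⟨s • v, hs _ hv, by simp⟩
    obtain ⟨I, hmono, hle, ⟨e'⟩⟩ := ih M' hM'
    let J : Fin (N + 1) → FracIdeal R K := Fin.cons ⟨I₀, hI₀⟩ I
    have hJ : ∀ i, Subalgebra.toSubmodule (multSubalgebra K M) ≤ (J i).multRing := by
      refine Fin.cases ?_ fun i => ?_
      · exact hmult.le
      · exact hS.trans (hle i)
    refine ⟨J, fun i j hij => ?_, hJ, ⟨?_⟩⟩
    · induction i using Fin.cases with
      | zero =>
        have : (J 0).multRing = Subalgebra.toSubmodule (multSubalgebra K M) := hmult.symm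
        exact this.le.trans (hJ j)
      | succ i =>
        induction j using Fin.cases with
        | zero => exact absurd hij (by simp)
        | succ j => exact hmono (Fin.succ_le_succ_iff.1 hij)
    · have e₁ : (M ⊓ (LinearMap.ker φ).restrictScalars R : Submodule R (Fin (N + 1) → K)) ≃ₗ[R]
          M.comap g :=
        { toFun := fun v => ⟨⟨v, v.2.2⟩, v.2.1⟩
          map_add' := fun _ _ => rfl
          map_smul' := fun _ _ => rfl
          invFun := fun v => ⟨v, v.2, v.1.2⟩
          left_inv := fun _ => rfl
          right_inv := fun _ => rfl }
      have e₂ : M.comap g ≃ₗ[R] M' := (ε.restrictScalars R).submoduleMap (M.comap g)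
      exact e ≪≫ₗ ((LinearEquiv.refl R I₀).prodCongr (e₁ ≪≫ₗ e₂ ≪≫ₗ e')) ≪≫ₗ
        Fin.consLinearEquiv R fun i => (J i).1

end Structure

/-! ### Products of ideals and multiplicator rings -/

section Products

variable {R K : Type*} [CommRing R] [CommRing K] [Algebra R K] {ι : Type*} [Fintype ι]

omit [Fintype ι] in
theorem prod_mul_mem_prod (s : Finset ι) {A B : ι → Submodule R K} {c : ι → K}
    (h : ∀ i ∈ s, ∀ x ∈ A i, c i * x ∈ B i) :
    ∀ x ∈ ∏ i ∈ s, A i, (∏ i ∈ s, c i) * x ∈ ∏ i ∈ s, B i := by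
  classical
  induction s using Finset.induction_on with
  | empty => simp
  | insert a s ha ih =>
    intro x hx
    rw [Finset.prod_insert ha] at hx ⊢
    rw [Finset.prod_insert ha]
    have ih' := ih fun i hi => h i (Finset.mem_insert_of_mem hi)
    refine Submodule.mul_induction_on hx (fun u hu v hv => ?_) fun u v hu hv => ?_
    · rw [mul_mul_mul_comm]
      exact Submodule.mul_mem_mul (h a (Finset.mem_insert_self a s) u hu) (ih' v hv)
    · rw [mul_add]
      exact Submodule.add_mem _ hu hv

theorem div_self_le_prod_div_prod {A : ι → Submodule R K} (i : ι) :
    A i / A i ≤ (∏ i, A i) / ∏ i, A i := by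
  classical
  intro x hx
  rw [Submodule.mem_div_iff_forall_mul_mem] at hx ⊢
  intro y hy
  have h := prod_mul_mem_prod Finset.univ (A := A) (B := A) (c := fun j => if j = i then x else 1)
    (fun j _ z hz => by
      split_ifs with hj
      · subst hj; exact hx z hz
      · rwa [one_mul]) y hy
  simpa using h

theorem prod_le_div_self {A : ι → Submodule R K} {I : Submodule R K} (h : ∀ i, A i ≤ I / I) :
    ∏ i, A i ≤ I / I := by
  refine Finset.prod_induction A (· ≤ I / I) (fun B C hB hC => ?_) ?_ fun i _ => h i
  · exact Submodule.mul_le.2 fun b hb c hc => mul_mem_div_self (hB hb) (hC hc)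
  · rw [← toSubmodule_multSubalgebra]
    intro x hx
    obtain ⟨r, rfl⟩ := Submodule.mem_one.1 hx
    exact (multSubalgebra K I).algebraMap_mem r

/-- The multiplicator ring of a product of invertible ideals lies in every ring that contains the
multiplicator rings of all the factors. -/
theorem prod_div_prod_le {A : ι → Submodule R K} {I : Submodule R K}
    (hinv : ∀ i, A i * ((A i / A i) / A i) = A i / A i) (hle : ∀ i, A i / A i ≤ I / I) :
    (∏ i, A i) / ∏ i, A i ≤ I / I := by
  intro x hx
  have hprod : (∏ i, A i) * ∏ i, (A i / A i) / A i = ∏ i, A i / A i := by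
    rw [← Finset.prod_mul_distrib]
    exact Finset.prod_congr rfl fun i _ => hinv i
  have h1 : (1 : K) ∈ ∏ i, A i / A i := by
    exact Finset.prod_induction _ (fun T : Submodule R K => (1 : K) ∈ T)
      (fun _ _ hS hT => by simpa using Submodule.mul_mem_mul hS hT)
      (Submodule.mem_one.2 ⟨1, map_one _⟩) fun i _ => one_mem_div_self (A i)
  refine prod_le_div_self hle ?_
  rw [← hprod] at h1 ⊢
  have key : ∀ y ∈ (∏ i, A i) * ∏ i, (A i / A i) / A i,
      x * y ∈ (∏ i, A i) * ∏ i, (A i / A i) / A i := fun y hy => by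
    refine Submodule.mul_induction_on hy (fun u hu v hv => ?_) fun u v hu hv => ?_
    · rw [← mul_assoc]
      exact Submodule.mul_mem_mul (Submodule.mem_div_iff_forall_mul_mem.1 hx u hu) hv
    · rw [mul_add]; exact Submodule.add_mem _ hu hv
  simpa using key 1 h1

end Products

/-! ### The Steinitz normal form -/

section Normal

variable {R K : Type*} [CommRing R] [CommRing K] [Algebra R K] [Algebra ℚ K] [Module.Finite ℤ R]

/-- Over a Bass order, `I₁ ⊕ ⋯ ⊕ I_N ≃ S₁ ⊕ ⋯ ⊕ S_{N-1} ⊕ I₁ ⋯ I_N` with `Sᵢ = (Iᵢ : Iᵢ)`. -/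
theorem nonempty_normalForm (hB : IsBassOrder R K) {N : ℕ} (I : Fin (N + 1) → FracIdeal R K)
    (hI : Monotone fun i => (I i).multRing) :
    Nonempty ((∀ i, (I i).1) ≃ₗ[R]
      (∀ i : Fin N, (I i.castSucc).multRing) × (∏ i, (I i).1 : Submodule R K)) := by
  induction N with
  | zero =>
    have h : ∏ i, (I i).1 = (I 0).1 := by simp
    exact ⟨
      { toFun := fun v => (fun i => i.elim0, LinearEquiv.ofEq _ _ h.symm (v 0))
        map_add' := fun v w => by ext i <;> first | exact i.elim0 | rfl
        map_smul' := fun r v => by ext i <;> first | exact i.elim0 | rfl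
        invFun := fun p => Fin.cons (α := fun i => (I i).1) (LinearEquiv.ofEq _ _ h p.2)
          fun i => i.elim0
        left_inv := fun v => by
          funext i
          induction i using Fin.cases with
          | zero => rfl
          | succ i => exact i.elim0
        right_inv := fun p => by
          ext i
          · exact i.elim0
          · rfl }⟩
  | succ N ih =>
    obtain ⟨e⟩ := ih (fun i => I i.succ) (hI.comp (Fin.strictMono_succ.monotone))
    have hP : IsFracIdeal R K (∏ i : Fin (N + 1), (I i.succ).1) :=
      (FracIdeal.prod N.succ_pos fun i => I i.succ).2
    obtain ⟨e'⟩ := nonempty_prod_equiv (I 0).2 hP (hB.mul_div_cancel (I 0).2)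
      ((hI (Fin.zero_le (Fin.succ 0))).trans
        (div_self_le_prod_div_prod (A := fun i : Fin (N + 1) => (I i.succ).1) 0))
    have h : (I 0).1 * ∏ i : Fin (N + 1), (I i.succ).1 = ∏ i, (I i).1 :=
      (Fin.prod_univ_succ fun i => (I i).1).symm
    let e₁ := (Fin.consLinearEquiv R fun i => (I i).1).symm
    let e₂ := (LinearEquiv.refl R (I 0).1).prodCongr e
    let e₃ := e'.trans ((LinearEquiv.refl R ((I 0).1 / (I 0).1 : Submodule R K)).prodCongr
      (LinearEquiv.ofEq _ _ h))
    let e₄ := Fin.consLinearEquiv R fun i : Fin (N + 1) => (I i.castSucc).multRing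
    let A := ∀ i : Fin N, (I i.castSucc.succ).multRing
    exact ⟨e₁ ≪≫ₗ e₂ ≪≫ₗ
      (LinearEquiv.refl R (I 0).1).prodCongr (LinearEquiv.prodComm R A _) ≪≫ₗ
      (LinearEquiv.prodAssoc R _ _ _).symm ≪≫ₗ
      e₃.prodCongr (LinearEquiv.refl R A) ≪≫ₗ
      LinearEquiv.prodAssoc R _ _ _ ≪≫ₗ
      (LinearEquiv.refl R _).prodCongr (LinearEquiv.prodComm R _ A) ≪≫ₗ
      (LinearEquiv.prodAssoc R _ _ _).symm ≪≫ₗ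
      e₄.prodCongr (LinearEquiv.refl R _)⟩

end Normal

/-! ### Invariants of a sum of ideals -/

section Invariants

variable {R K : Type*} [CommRing R] [CommRing K] [Algebra R K] [Algebra ℚ K]

/-- A homomorphism from a fractional ideal to `K` is multiplication by an element of `K`. -/
theorem exists_eq_mul (h1 : IsFracIdeal R K (1 : Submodule R K)) {I : Submodule R K}
    (hI : IsFracIdeal R K I) (φ : I →ₗ[R] K) : ∃ c : K, ∀ x : I, φ x = c * x := by
  obtain ⟨n, hn, hn1⟩ := hI.full 1
  refine ⟨(n : ℚ)⁻¹ • φ ⟨_, hn1⟩, fun x => ?_⟩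
  obtain ⟨k, hk, hkx⟩ := h1.full (x : K)
  obtain ⟨r, hr⟩ := Submodule.mem_one.1 hkx
  have hn' : (n : ℚ) ≠ 0 := by exact_mod_cast hn
  refine zsmul_injective_of_rat (mul_ne_zero hk hn) ?_
  have h2 : (k * n) • x = r • (⟨_, hn1⟩ : I) := by
    ext
    change (k * n) • (x : K) = r • (n • (1 : K))
    rw [Algebra.smul_def r, hr]
    simp only [zsmul_eq_mul]
    push_cast
    ring
  have h3 : n • ((n : ℚ)⁻¹ • φ ⟨_, hn1⟩) = φ ⟨_, hn1⟩ := by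
    rw [← Int.cast_smul_eq_zsmul ℚ, smul_smul, mul_inv_cancel₀ hn', one_smul]
  change (k * n) • φ x = (k * n) • ((n : ℚ)⁻¹ • φ ⟨_, hn1⟩ * (x : K))
  rw [← map_zsmul, h2, map_smul, Algebra.smul_def, hr, mul_smul, ← smul_mul_assoc, h3,
    ← mul_smul_comm, mul_comm]

/-- An isomorphism of sums of fractional ideals is given by an invertible matrix over `K`. -/
theorem exists_matrix_of_equiv (h1 : IsFracIdeal R K (1 : Submodule R K)) {N : ℕ}
    (I J : Fin N → FracIdeal R K) (e : (∀ i, (I i).1) ≃ₗ[R] ∀ i, (J i).1) :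
    ∃ G H : Matrix (Fin N) (Fin N) K, (∀ i j, ∀ x ∈ (I j).1, G i j * x ∈ (J i).1) ∧
      (∀ i j, ∀ x ∈ (J j).1, H i j * x ∈ (I i).1) ∧ G * H = 1 := by
  have aux : ∀ (I J : Fin N → FracIdeal R K) (e : (∀ i, (I i).1) →ₗ[R] ∀ i, (J i).1),
      ∃ G : Matrix (Fin N) (Fin N) K, ∀ i j (x : (I j).1),
        (e (Pi.single j x) i : K) = G i j * x := by
    intro I J e
    choose G hG using fun i j => exists_eq_mul h1 (I j).2
      ((J i).1.subtype ∘ₗ LinearMap.proj i ∘ₗ e ∘ₗ LinearMap.single R (fun i => (I i).1) j)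
    exact ⟨Matrix.of G, fun i j x => hG i j x⟩
  obtain ⟨G, hG⟩ := aux I J e
  obtain ⟨H, hH⟩ := aux J I e.symm
  simp only [LinearEquiv.coe_coe] at hG hH
  refine ⟨G, H, fun i j x hx => ?_, fun i j x hx => ?_, ?_⟩
  · rw [← hG i j ⟨x, hx⟩]; exact Subtype.prop _
  · rw [← hH i j ⟨x, hx⟩]; exact Subtype.prop _
  · have hGv : ∀ (v : ∀ i, (I i).1) i, (e v i : K) = ∑ j, G i j * (v j : K) := by
      intro v i
      conv_lhs => rw [← Finset.univ_sum_single v, map_sum, Finset.sum_apply]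
      push_cast
      exact Finset.sum_congr rfl fun j _ => hG i j (v j)
    refine Matrix.ext fun i l => ?_
    obtain ⟨n, hn, hn1⟩ := (J l).2.full 1
    have h := hGv (e.symm (Pi.single l ⟨_, hn1⟩)) i
    rw [LinearEquiv.apply_symm_apply] at h
    simp only [hH] at h
    suffices h : n • (G * H) i l = n • (1 : Matrix (Fin N) (Fin N) K) i l from
      zsmul_injective_of_rat hn h
    rw [Matrix.mul_apply, Finset.smul_sum]
    calc ∑ j, n • (G i j * H j l) = ∑ j, G i j * (H j l * n • (1 : K)) :=
          Finset.sum_congr rfl fun j _ => by simp only [zsmul_eq_mul]; ring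
      _ = _ := h.symm
      _ = n • (1 : Matrix (Fin N) (Fin N) K) i l := by
          by_cases hil : i = l
          · subst hil; simp
          · simp [hil]

omit [Algebra ℚ K] in
theorem det_mul_mem_prod {ι : Type*} [Fintype ι] [DecidableEq ι] {A B : ι → Submodule R K}
    {G : Matrix ι ι K} (hG : ∀ i j, ∀ x ∈ A j, G i j * x ∈ B i) :
    ∀ x ∈ ∏ i, A i, G.det * x ∈ ∏ i, B i := by
  intro x hx
  rw [Matrix.det_apply', Finset.sum_mul]
  refine Submodule.sum_mem _ fun σ _ => ?_
  rw [mul_assoc, ← zsmul_eq_mul]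
  refine Submodule.smul_of_tower_mem _ _ ?_
  rw [← Equiv.prod_comp σ B]
  exact prod_mul_mem_prod Finset.univ (fun i _ x hx => hG (σ i) i x hx) x hx

omit [Algebra ℚ K] in
/-- The determinant of an isomorphism of sums identifies the products of the ideals. -/
theorem nonempty_prod_equiv_of_matrix {ι : Type*} [Fintype ι] [DecidableEq ι]
    {A B : ι → Submodule R K} {G H : Matrix ι ι K} (hG : ∀ i j, ∀ x ∈ A j, G i j * x ∈ B i)
    (hH : ∀ i j, ∀ x ∈ B j, H i j * x ∈ A i) (hGH : G * H = 1) :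
    Nonempty ((∏ i, A i : Submodule R K) ≃ₗ[R] (∏ i, B i : Submodule R K)) := by
  have hdet : G.det * H.det = 1 := by rw [← Matrix.det_mul, hGH, Matrix.det_one]
  exact ⟨
    { toFun := fun x => ⟨G.det * x, det_mul_mem_prod hG x x.2⟩
      map_add' := fun x y => by ext; simp [mul_add]
      map_smul' := fun r x => by ext; simp
      invFun := fun x => ⟨H.det * x, det_mul_mem_prod hH x x.2⟩
      left_inv := fun x => by
        ext
        change H.det * (G.det * x) = x
        linear_combination (x : K) * hdet
      right_inv := fun x => by
        ext
        change G.det * (H.det * x) = x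
        linear_combination (x : K) * hdet }⟩

omit [Algebra ℚ K] in
theorem det_mul_eq_sum_injective {m n : Type*} [Fintype m] [Fintype n] [DecidableEq m]
    [DecidableEq n] (G : Matrix m n K) (H : Matrix n m K) :
    (G * H).det = ∑ p : m → n with Function.Injective p, ∑ σ : Equiv.Perm m,
      (Equiv.Perm.sign σ : ℤ) • ∏ i, G (σ i) (p i) * H (p i) i := by
  have h : (G * H).det = ∑ p : m → n, ∑ σ : Equiv.Perm m,
      (Equiv.Perm.sign σ : ℤ) • ∏ i, G (σ i) (p i) * H (p i) i := by
    simp only [Matrix.det_apply', Matrix.mul_apply, Finset.prod_univ_sum, Finset.mul_sum,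
      Fintype.piFinset_univ, zsmul_eq_mul]
    rw [Finset.sum_comm]
  rw [h]
  refine (Finset.sum_subset (Finset.filter_subset _ _) fun p _ hp => ?_).symm
  have hp : ¬ Function.Injective p := fun h => hp (by simpa using h)
  simp only [Function.Injective, not_forall] at hp
  obtain ⟨i, j, hij, hne⟩ := hp
  have h0 : (G.submatrix id p).det = 0 :=
    Matrix.det_zero_of_column_eq hne fun k => by simp [hij]
  calc _ = (G.submatrix id p).det * ∏ i, H (p i) i := by
        rw [Matrix.det_apply', Finset.sum_mul]
        refine Finset.sum_congr rfl fun σ _ => ?_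
        rw [Finset.prod_mul_distrib, zsmul_eq_mul, mul_assoc]
        rfl
    _ = 0 := by rw [h0, zero_mul]

omit [Algebra ℚ K] in
/-- The `k`-th multiplicator ring is an isomorphism invariant of the sum. Expand the determinant of
the block of the identity `G H = 1` with indices `≤ k` into products over injective maps `p`: each
`p` takes a value `p i ≥ k`, so an element `x` of `(A k : A k)` can be absorbed in passing through
`A (p i)`. Hence `x` preserves the product of the `B i` with `i ≤ k`, whose multiplicator ring is
that of `B k`. -/
theorem multRing_le_of_matrix {N : ℕ} {A B : Fin N → Submodule R K}
    {G H : Matrix (Fin N) (Fin N) K} (hG : ∀ i j, ∀ x ∈ A j, G i j * x ∈ B i)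
    (hH : ∀ i j, ∀ x ∈ B j, H i j * x ∈ A i) (hGH : G * H = 1)
    (hA : Monotone fun i => A i / A i) (hB : Monotone fun i => B i / B i)
    (hinv : ∀ i, B i * ((B i / B i) / B i) = B i / B i) (k : Fin N) :
    A k / A k ≤ B k / B k := by
  intro x hx
  let ι := {i : Fin N // i ≤ k}
  refine prod_div_prod_le (ι := ι) (A := fun i => B i) (fun i => hinv i) (fun i => hB i.2) ?_
  rw [Submodule.mem_div_iff_forall_mul_mem]
  intro y hy
  let G' : Matrix ι (Fin N) K := G.submatrix Subtype.val id
  let H' : Matrix (Fin N) ι K := H.submatrix id Subtype.val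
  have hdet : (G' * H').det = 1 := by
    have : G' * H' = 1 := by
      rw [← Matrix.submatrix_mul _ _ _ _ _ Function.bijective_id, hGH,
        Matrix.submatrix_one _ Subtype.val_injective]
    rw [this, Matrix.det_one]
  rw [← mul_one x, ← hdet, det_mul_eq_sum_injective, Finset.mul_sum, Finset.sum_mul]
  refine Submodule.sum_mem _ fun p hp => ?_
  have hp : Function.Injective p := (Finset.mem_filter.1 hp).2
  obtain ⟨i₀, hi₀⟩ : ∃ i₀, k ≤ p i₀ := by
    by_contra! hlt
    have hcard : Fintype.card {i : Fin N // i ≤ k} ≤ Fintype.card {j : Fin N // j < k} :=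
      Fintype.card_le_of_injective (fun i : ι => (⟨p i, hlt i⟩ : {j : Fin N // j < k}))
        fun a b hab => hp (congrArg Subtype.val hab)
    have hss : Finset.univ.filter (fun j : Fin N => j < k) ⊂
        Finset.univ.filter (fun j : Fin N => j ≤ k) := by
      refine Finset.ssubset_iff_of_subset (fun j hj => ?_) |>.2 ⟨k, by simp, by simp⟩
      simp only [Finset.mem_filter, Finset.mem_univ, true_and] at hj ⊢
      exact hj.le
    have := Finset.card_lt_card hss
    rw [← Fintype.card_subtype, ← Fintype.card_subtype] at this
    omega
  rw [Finset.mul_sum, Finset.sum_mul]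
  refine Submodule.sum_mem _ fun σ _ => ?_
  rw [mul_smul_comm, smul_mul_assoc]
  refine Submodule.smul_of_tower_mem _ _ ?_
  have hx' : ∀ i : ι, ∀ a ∈ A (p i), (if i = i₀ then x else 1) * a ∈ A (p i) := fun i a ha => by
    split_ifs with h
    · subst h
      exact Submodule.mem_div_iff_forall_mul_mem.1 (hA hi₀ hx) a ha
    · rwa [one_mul]
  have hfac : x * ∏ i, G' (σ i) (p i) * H' (p i) i =
      ∏ i, G' (σ i) (p i) * ((if i = i₀ then x else 1) * H' (p i) i) := by
    simp only [Finset.prod_mul_distrib, Finset.prod_ite_eq', Finset.mem_univ, if_true]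
    ring
  rw [hfac, ← Equiv.prod_comp σ fun i : ι => B i]
  refine prod_mul_mem_prod Finset.univ (fun i _ z hz => ?_) y hy
  rw [mul_assoc, mul_assoc]
  exact hG _ _ _ (hx' i _ (hH _ _ _ hz))

variable [Module.Finite ℤ R]

/-- Two sums with increasing multiplicator rings are isomorphic exactly when the multiplicator
rings agree and the products of the ideals are isomorphic. -/
theorem nonempty_directSum_equiv_iff (h1 : IsFracIdeal R K (1 : Submodule R K))
    (hB : IsBassOrder R K) {N : ℕ} (hN : 0 < N) (I J : FracIdealChain R K N) :
    Nonempty (I.directSum ≃ₗ[R] J.directSum) ↔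
      (∀ i, (I.1 i).multRing = (J.1 i).multRing) ∧
        ICM.mk (FracIdeal.prod hN I.1) = ICM.mk (FracIdeal.prod hN J.1) := by
  constructor
  · rintro ⟨e⟩
    obtain ⟨G, H, hG, hH, hGH⟩ := exists_matrix_of_equiv h1 I.1 J.1 e
    refine ⟨fun k => le_antisymm ?_ ?_, ?_⟩
    · exact multRing_le_of_matrix hG hH hGH I.2 J.2 (fun i => hB.mul_div_cancel (J.1 i).2) k
    · exact multRing_le_of_matrix hH hG (mul_eq_one_comm.1 hGH) J.2 I.2
        (fun i => hB.mul_div_cancel (I.1 i).2) k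
    · exact Quotient.sound (nonempty_prod_equiv_of_matrix hG hH hGH)
  · rintro ⟨hmult, hcl⟩
    obtain ⟨N, rfl⟩ := Nat.exists_eq_succ_of_ne_zero hN.ne'
    obtain ⟨e⟩ : Nonempty _ := Quotient.exact hcl
    obtain ⟨a⟩ := nonempty_normalForm hB I.1 I.2
    obtain ⟨b⟩ := nonempty_normalForm hB J.1 J.2
    exact ⟨a ≪≫ₗ (LinearEquiv.piCongrRight fun i : Fin N =>
      LinearEquiv.ofEq _ _ (hmult i.castSucc)).prodCongr e ≪≫ₗ b.symm⟩

end Invariants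

/-! ### Conjugacy classes of matrices and modules over `ℤ[x]/(f)` -/

section Bridge

variable {f : ℤ[X]} {M M' : Type*} [AddCommGroup M] [Module (AdjoinRoot f) M]
  [AddCommGroup M'] [Module (AdjoinRoot f) M']

theorem map_smul_of_map_root_smul (e : M →+ M')
    (he : ∀ m, e (AdjoinRoot.root f • m) = AdjoinRoot.root f • e m) (r : AdjoinRoot f) (m : M) :
    e (r • m) = r • e m := by
  induction r using AdjoinRoot.induction_on with
  | ih p =>
    induction p using Polynomial.induction_on generalizing m with
    | C a =>
      rw [AdjoinRoot.mk_C, eq_intCast, Int.cast_smul_eq_zsmul, Int.cast_smul_eq_zsmul, map_zsmul]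
    | add p q hp hq => rw [map_add, add_smul, add_smul, map_add, hp, hq]
    | monomial n a h =>
      rw [pow_succ, ← mul_assoc, map_mul, AdjoinRoot.mk_X, mul_smul, h, he, mul_smul]

variable {n : ℕ} {A B : Matrix (Fin n) (Fin n) ℤ}

theorem _root_.IsMatrixOfRoot.congr (e : M ≃ₗ[AdjoinRoot f] M') (h : IsMatrixOfRoot f A M) :
    IsMatrixOfRoot f A M' := by
  obtain ⟨w, rfl⟩ := h
  refine ⟨w.map (e.restrictScalars ℤ), ?_⟩
  ext i j
  simp [LinearMap.toMatrix_apply]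

theorem _root_.IsMatrixOfRoot.exists_conj (hA : IsMatrixOfRoot f A M) (hB : IsMatrixOfRoot f B M) :
    ∃ O : GL (Fin n) ℤ, O.1 * A * (O⁻¹).1 = B := by
  obtain ⟨w, rfl⟩ := hA
  obtain ⟨w', rfl⟩ := hB
  exact ⟨⟨w'.toMatrix w, w.toMatrix w', Module.Basis.toMatrix_mul_toMatrix_flip _ _,
    Module.Basis.toMatrix_mul_toMatrix_flip _ _⟩,
    basis_toMatrix_mul_linearMap_toMatrix_mul_basis_toMatrix w' w w' w _⟩

theorem _root_.IsMatrixOfRoot.conj (hA : IsMatrixOfRoot f A M) (O : GL (Fin n) ℤ)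
    (h : O.1 * A * (O⁻¹).1 = B) : IsMatrixOfRoot f B M := by
  obtain ⟨w, rfl⟩ := hA
  let e : (Fin n → ℤ) ≃ₗ[ℤ] (Fin n → ℤ) := Matrix.toLin'OfInv (M := (O⁻¹).1) (M' := O.1)
    (by simp) (by simp)
  let w' : Module.Basis (Fin n) ℤ M := Module.Basis.ofEquivFun (w.equivFun.trans e)
  have h1 : w'.toMatrix w = O.1 := by
    ext i j
    simp [w', e, Module.Basis.toMatrix_apply, Matrix.toLin'OfInv, Finsupp.single_eq_pi_single]
  have h2 : w.toMatrix w' = (O⁻¹).1 := by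
    have : O.1 * w.toMatrix w' = 1 := by rw [← h1, Module.Basis.toMatrix_mul_toMatrix_flip]
    calc w.toMatrix w' = (O⁻¹).1 * (O.1 * w.toMatrix w') := by rw [← mul_assoc]; simp
      _ = _ := by rw [this, mul_one]
  refine ⟨w', ?_⟩
  rw [← h, ← h1, ← h2, basis_toMatrix_mul_linearMap_toMatrix_mul_basis_toMatrix]

theorem _root_.IsMatrixOfRoot.nonempty_equiv (hA : IsMatrixOfRoot f A M)
    (hA' : IsMatrixOfRoot f A M') :
    Nonempty (M ≃ₗ[AdjoinRoot f] M') := by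
  obtain ⟨w, h⟩ := hA
  obtain ⟨w', h'⟩ := hA'
  let e : M ≃ₗ[ℤ] M' := w.equivFun.trans w'.equivFun.symm
  have he : ∀ m, e (AdjoinRoot.root f • m) = AdjoinRoot.root f • e m := fun m => by
    apply w'.equivFun.injective
    have h1 := LinearMap.toMatrix_mulVec_repr w w
      (DistribSMul.toAddMonoidHom M (AdjoinRoot.root f)).toIntLinearMap m
    have h2 := LinearMap.toMatrix_mulVec_repr w' w'
      (DistribSMul.toAddMonoidHom M' (AdjoinRoot.root f)).toIntLinearMap (e m)
    have h3 : (w'.repr (e m) : Fin n → ℤ) = w.repr m := by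
      change w'.equivFun (e m) = w.equivFun m
      simp only [e, LinearEquiv.trans_apply, LinearEquiv.apply_symm_apply]
    rw [h', h3] at h2
    rw [h] at h1
    have h4 : w'.equivFun (e (AdjoinRoot.root f • m)) = w.equivFun (AdjoinRoot.root f • m) := by
      simp only [e, LinearEquiv.trans_apply, LinearEquiv.apply_symm_apply]
    rw [h4]
    exact h1.symm.trans h2
  exact ⟨{ e with map_smul' := fun r m => map_smul_of_map_root_smul e.toAddMonoidHom he r m }⟩

/-- Matrix classes correspond to isomorphism classes in any family of modules `X i` that realizes,
up to isomorphism, exactly the modules `ℤ ^ n` with `x` acting by such a matrix. -/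
theorem exists_matrixClasses_equiv {c : ℤ[X]} {ι : Type*} (s : Setoid ι) (X : ι → Type*)
    [∀ i, AddCommGroup (X i)] [∀ i, Module (AdjoinRoot f) (X i)]
    (hs : ∀ i j, s i j ↔ Nonempty (X i ≃ₗ[AdjoinRoot f] X j))
    (h₁ : ∀ i, ∃ A : IntMatrices f c, IsMatrixOfRoot f A.1 (X i))
    (h₂ : ∀ A : IntMatrices f c, ∃ i, IsMatrixOfRoot f A.1 (X i)) :
    ∃ e : MatrixClasses f c ≃ Quotient s, ∀ (A : IntMatrices f c) (i : ι),
      e (MatrixClasses.mk A) = Quotient.mk s i ↔ IsMatrixOfRoot f A.1 (X i) := by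
  choose g hg using h₂
  have key : ∀ A i, s (g A) i ↔ IsMatrixOfRoot f A.1 (X i) := fun A i =>
    ⟨fun h => ((hs _ _).1 h).elim fun e => (hg A).congr e,
      fun h => (hs _ _).2 ((hg A).nonempty_equiv h)⟩
  let F : MatrixClasses f c → Quotient s :=
    Quotient.map' (s₁ := IntMatrices.conjSetoid f c) g fun A B ⟨O, h⟩ =>
      s.symm ((key B _).2 ((hg A).conj O h))
  have hF : Function.Bijective F := by
    refine ⟨?_, ?_⟩
    · rintro ⟨A⟩ ⟨B⟩ hAB
      have h : s (g A) (g B) := Quotient.exact hAB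
      exact Quotient.sound (((key A _).1 h).exists_conj (hg B))
    · rintro ⟨i⟩
      obtain ⟨A, hA⟩ := h₁ i
      exact ⟨MatrixClasses.mk A, Quotient.sound ((key A i).2 hA)⟩
  exact ⟨Equiv.ofBijective F hF, fun A i => Quotient.eq.trans (key A i)⟩

end Bridge

/-! ### The order `ℤ[x]/(f)` and its total quotient ring -/

section Monogenic

variable {f : ℤ[X]}

theorem isReduced_adjoinRoot (hf : f.Monic) (hsq : Squarefree f) : IsReduced (AdjoinRoot f) := by
  have h := (isRadical_iff_squarefree_of_ne_zero hf.ne_zero).2 hsq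
  rw [isRadical_iff_span_singleton] at h
  exact (Ideal.isRadical_iff_quotient_reduced _).1 h

theorem torsionFree_adjoinRoot (hf : f.Monic) : Module.IsTorsionFree ℤ (AdjoinRoot f) := by
  have := hf.free_adjoinRoot
  infer_instance

theorem intCast_mem_nonZeroDivisors (hf : f.Monic) {n : ℤ} (hn : n ≠ 0) :
    (n : AdjoinRoot f) ∈ nonZeroDivisors (AdjoinRoot f) := by
  have := torsionFree_adjoinRoot hf
  rw [mem_nonZeroDivisors_iff_right]
  intro x hx
  rw [mul_comm, ← zsmul_eq_mul] at hx
  exact (smul_eq_zero.1 hx).resolve_left hn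

variable (K : Type*) [CommRing K] [Algebra (AdjoinRoot f) K] [IsFractionRing (AdjoinRoot f) K]

/-- The total quotient ring of `ℤ[x]/(f)` is a `ℚ`-algebra. -/
@[reducible] noncomputable def ratAlgebra (hf : f.Monic) : Algebra ℚ K :=
  (IsLocalization.lift (M := nonZeroDivisors ℤ) (S := ℚ) (g := Int.castRingHom K) fun n => by
    have := IsLocalization.map_units K
      (⟨_, intCast_mem_nonZeroDivisors hf (nonZeroDivisors.ne_zero n.2)⟩ :
        nonZeroDivisors (AdjoinRoot f))
    simpa using this).toAlgebra

theorem exists_dvd_intCast (hf : f.Monic) {r : AdjoinRoot f}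
    (hr : r ∈ nonZeroDivisors (AdjoinRoot f)) : ∃ n : ℤ, n ≠ 0 ∧ r ∣ (n : AdjoinRoot f) := by
  have := hf.finite_adjoinRoot
  have hint : IsIntegral ℤ r := Algebra.IsIntegral.isIntegral r
  simpa using hint.isAlgebraic.exists_nonzero_dvd hr

theorem isFracIdeal_one (hf : f.Monic) :
    IsFracIdeal (AdjoinRoot f) K (1 : Submodule (AdjoinRoot f) K) := by
  refine ⟨?_, fun x => ?_⟩
  · rw [Submodule.one_eq_span]; exact Submodule.fg_span_singleton _
  · obtain ⟨⟨a, s⟩, hx⟩ := IsLocalization.surj (nonZeroDivisors (AdjoinRoot f)) x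
    obtain ⟨n, hn, t, ht⟩ := exists_dvd_intCast hf s.2
    refine ⟨n, hn, Submodule.mem_one.2 ⟨a * t, ?_⟩⟩
    rw [map_mul, ← hx, zsmul_eq_mul, ← map_intCast (algebraMap (AdjoinRoot f) K), ht, map_mul]
    ring

variable [Algebra ℚ K]

theorem isReduced_of_order (hf : f.Monic) (hsq : Squarefree f) : IsReduced K := by
  have := isReduced_adjoinRoot hf hsq
  refine ⟨fun x ⟨k, hk⟩ => ?_⟩
  obtain ⟨n, hn, hx⟩ := (isFracIdeal_one K hf).full x
  obtain ⟨r, hr⟩ := Submodule.mem_one.1 hx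
  have hr0 : r = 0 := by
    refine IsReduced.eq_zero r ⟨k, IsFractionRing.injective (AdjoinRoot f) K ?_⟩
    rw [map_pow, hr, _root_.smul_pow, hk, smul_zero, map_zero]
  rw [hr0, map_zero] at hr
  refine zsmul_injective_of_rat hn ?_
  change n • x = n • 0
  rw [← hr, smul_zero]

/-- A full lattice localizes to the ambient space, so its `ℤ`-bases are rational bases. -/
theorem isLocalizedModule_lattice {V M : Type*} [AddCommGroup V] [Module ℚ V] [AddCommGroup M]
    [Module (AdjoinRoot f) M] [Module (AdjoinRoot f) V] (j : M →ₗ[AdjoinRoot f] V)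
    (hj : Function.Injective j) (hfull : ∀ x : V, ∃ n : ℤ, n ≠ 0 ∧ ∃ m, j m = n • x) :
    IsLocalizedModule (nonZeroDivisors ℤ) (j.restrictScalars ℤ) :=
  isLocalizedModule_of_full (j.restrictScalars ℤ) hj hfull

theorem exists_basis_order (hf : f.Monic) :
    Nonempty (Module.Basis (Fin f.natDegree) ℚ K) := by
  have := isLocalizedModule_lattice (f := f) (V := K) (Algebra.linearMap (AdjoinRoot f) K)
    (IsFractionRing.injective (AdjoinRoot f) K) fun x => by
      obtain ⟨n, hn, hx⟩ := (isFracIdeal_one K hf).full x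
      exact ⟨n, hn, Submodule.mem_one.1 hx⟩
  exact ⟨(AdjoinRoot.powerBasis' hf).basis.ofIsLocalizedModule ℚ (nonZeroDivisors ℤ)
    ((Algebra.linearMap (AdjoinRoot f) K).restrictScalars ℤ)⟩

theorem finiteDimensional_order (hf : f.Monic) : FiniteDimensional ℚ K :=
  (exists_basis_order K hf).elim fun b => b.finiteDimensional_of_finite

theorem finrank_order (hf : f.Monic) : Module.finrank ℚ K = f.natDegree :=
  (exists_basis_order K hf).elim fun b => by simpa using Module.finrank_eq_card_basis b

omit [IsFractionRing (AdjoinRoot f) K] in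
theorem aeval_root_map (p : ℤ[X]) :
    aeval (algebraMap (AdjoinRoot f) K (AdjoinRoot.root f)) (p.map (Int.castRingHom ℚ)) =
      algebraMap (AdjoinRoot f) K (AdjoinRoot.mk f p) := by
  rw [← algebraMap_int_eq, aeval_map_algebraMap, aeval_algebraMap_apply, AdjoinRoot.aeval_eq]

theorem exists_eq_aeval_root (hf : f.Monic) (x : K) :
    ∃ g : ℚ[X], x = aeval (algebraMap (AdjoinRoot f) K (AdjoinRoot.root f)) g := by
  obtain ⟨n, hn, hx⟩ := (isFracIdeal_one K hf).full x
  obtain ⟨r, hr⟩ := Submodule.mem_one.1 hx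
  obtain ⟨p, rfl⟩ := AdjoinRoot.mk_surjective r
  have hn' : (n : ℚ) ≠ 0 := by exact_mod_cast hn
  refine ⟨(n : ℚ)⁻¹ • p.map (Int.castRingHom ℚ), ?_⟩
  rw [map_smul, aeval_root_map, hr, ← Int.cast_smul_eq_zsmul ℚ, smul_smul, inv_mul_cancel₀ hn',
    one_smul]

theorem minpoly_root (hf : f.Monic) :
    minpoly ℚ (algebraMap (AdjoinRoot f) K (AdjoinRoot.root f)) =
      f.map (Int.castRingHom ℚ) := by
  have := finiteDimensional_order K hf
  have hint : IsIntegral ℚ (algebraMap (AdjoinRoot f) K (AdjoinRoot.root f)) :=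
    Algebra.IsIntegral.isIntegral _
  refine eq_of_monic_of_associated (minpoly.monic hint) (hf.map _)
    (associated_of_dvd_dvd (minpoly.dvd _ _ ?_) ?_)
  · rw [aeval_root_map, AdjoinRoot.mk_self, map_zero]
  · obtain ⟨b, hbm, hb⟩ := IsLocalization.integerNormalization_spec (nonZeroDivisors ℤ)
      (minpoly ℚ (algebraMap (AdjoinRoot f) K (AdjoinRoot.root f)))
    set q := IsLocalization.integerNormalization (nonZeroDivisors ℤ)
      (minpoly ℚ (algebraMap (AdjoinRoot f) K (AdjoinRoot.root f)))
    rw [algebraMap_int_eq] at hb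
    have h0 : AdjoinRoot.mk f q = 0 := by
      apply IsFractionRing.injective (AdjoinRoot f) K
      rw [← aeval_root_map, hb, Algebra.smul_def, map_mul, minpoly.aeval, mul_zero, map_zero]
    have hdvd : f.map (Int.castRingHom ℚ) ∣ q.map (Int.castRingHom ℚ) :=
      Polynomial.map_dvd _ (AdjoinRoot.mk_eq_zero.1 h0)
    rw [hb] at hdvd
    have hb0 : (b : ℚ) ≠ 0 := by exact_mod_cast nonZeroDivisors.ne_zero hbm
    have hsm : b • minpoly ℚ (algebraMap (AdjoinRoot f) K (AdjoinRoot.root f)) =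
        C (b : ℚ) * minpoly ℚ (algebraMap (AdjoinRoot f) K (AdjoinRoot.root f)) := by
      rw [← Int.cast_smul_eq_zsmul ℚ, smul_eq_C_mul]
    rw [hsm] at hdvd
    exact (IsUnit.dvd_mul_left (isUnit_C.2 hb0.isUnit)).1 hdvd

end Monogenic

/-! ### Traces of polynomials in an endomorphism -/

section Charpoly

theorem det_aeval_eq_of_charpoly_eq {F : Type*} [Field F] {n : ℕ} {A B : Matrix (Fin n) (Fin n) F}
    (h : A.charpoly = B.charpoly) {g : F[X]} (hg : g.Splits) :
    (aeval A g).det = (aeval B g).det := by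
  have hlin : ∀ (A : Matrix (Fin n) (Fin n) F) (a : F),
      (aeval A (X + C a)).det = (-1) ^ n * A.charpoly.eval (-a) := fun A a => by
    have hneg := Matrix.det_neg (Matrix.scalar (Fin n) (-a) - A)
    rw [Fintype.card_fin] at hneg
    rw [Matrix.eval_charpoly, ← hneg]
    congr 1
    rw [map_add, aeval_X, aeval_C, neg_sub, map_neg, sub_neg_eq_add]
    rfl
  induction hg using Submonoid.closure_induction with
  | mem g hg =>
    rcases hg with ⟨a, rfl⟩ | ⟨a, rfl⟩
    · rw [aeval_C, aeval_C]
    · rw [hlin, hlin, h]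
  | one => rw [map_one, map_one]
  | mul p q _ _ hp hq => rw [map_mul, map_mul, Matrix.det_mul, Matrix.det_mul, hp, hq]

/-- The characteristic polynomial of `A` determines those of all polynomials in `A`. -/
theorem charpoly_aeval_eq_of_charpoly_eq {n : ℕ} {A B : Matrix (Fin n) (Fin n) ℚ}
    (h : A.charpoly = B.charpoly) (g : ℚ[X]) :
    (aeval A g).charpoly = (aeval B g).charpoly := by
  let Ω := AlgebraicClosure ℚ
  let φ : Matrix (Fin n) (Fin n) ℚ →ₐ[ℚ] Matrix (Fin n) (Fin n) Ω := (Algebra.ofId ℚ Ω).mapMatrix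
  have hdet : ∀ p : ℚ[X], (aeval A p).det = (aeval B p).det := fun p => by
    apply (algebraMap ℚ Ω).injective
    have hφ : ∀ A : Matrix (Fin n) (Fin n) ℚ,
        algebraMap ℚ Ω (aeval A p).det = (aeval (φ A) (p.map (algebraMap ℚ Ω))).det := fun A => by
      rw [aeval_map_algebraMap, aeval_algHom_apply]
      exact (algebraMap ℚ Ω).map_det _
    rw [hφ, hφ]
    refine det_aeval_eq_of_charpoly_eq ?_ (IsAlgClosed.splits _)
    have hc : ∀ A : Matrix (Fin n) (Fin n) ℚ,
        (φ A).charpoly = A.charpoly.map (algebraMap ℚ Ω) := fun A =>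
      Matrix.charpoly_map A (algebraMap ℚ Ω)
    rw [hc, hc, h]
  refine Polynomial.funext fun t => ?_
  have ht : ∀ A : Matrix (Fin n) (Fin n) ℚ,
      Matrix.scalar (Fin n) t - aeval A g = aeval A (C t - g) := fun A => by
    rw [map_sub, aeval_C]; rfl
  rw [Matrix.eval_charpoly, Matrix.eval_charpoly, ht, ht, hdet]

theorem trace_aeval_eq_of_charpoly_eq {V W : Type*} [AddCommGroup V] [Module ℚ V]
    [FiniteDimensional ℚ V] [AddCommGroup W] [Module ℚ W] [FiniteDimensional ℚ W]
    {T : Module.End ℚ V} {U : Module.End ℚ W} (h : LinearMap.charpoly T = LinearMap.charpoly U)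
    (g : ℚ[X]) : LinearMap.trace ℚ V (aeval T g) = LinearMap.trace ℚ W (aeval U g) := by
  have hd : Module.finrank ℚ V = Module.finrank ℚ W := by
    rw [← LinearMap.charpoly_natDegree T, h, LinearMap.charpoly_natDegree]
  let b := Module.finBasis ℚ V
  let c := Module.finBasisOfFinrankEq ℚ W hd.symm
  have hb : LinearMap.toMatrix b b (aeval T g) = aeval (LinearMap.toMatrix b b T) g :=
    (aeval_algHom_apply (LinearMap.toMatrixAlgEquiv b) T g).symm
  have hc : LinearMap.toMatrix c c (aeval U g) = aeval (LinearMap.toMatrix c c U) g :=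
    (aeval_algHom_apply (LinearMap.toMatrixAlgEquiv c) U g).symm
  rw [LinearMap.trace_eq_matrix_trace ℚ b, LinearMap.trace_eq_matrix_trace ℚ c, hb, hc,
    Matrix.trace_eq_neg_charpoly_nextCoeff, Matrix.trace_eq_neg_charpoly_nextCoeff,
    charpoly_aeval_eq_of_charpoly_eq]
  rw [LinearMap.charpoly_toMatrix, LinearMap.charpoly_toMatrix, h]

end Charpoly

/-! ### Matrices of lattices -/

section Matrices

variable {f : ℤ[X]} (K : Type*) [CommRing K] [Algebra (AdjoinRoot f) K]
  [IsFractionRing (AdjoinRoot f) K] [Algebra ℚ K]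

/-- Multiplication by the root on a `K`-module. -/
noncomputable abbrev rootEnd (V : Type*) [AddCommGroup V] [Module ℚ V] [Module K V]
    [IsScalarTower ℚ K V] : Module.End ℚ V :=
  Algebra.lsmul ℚ ℚ V (algebraMap (AdjoinRoot f) K (AdjoinRoot.root f))

theorem charpoly_rootEnd_self [FiniteDimensional ℚ K] (hf : f.Monic) :
    LinearMap.charpoly (rootEnd (f := f) K K) = f.map (Int.castRingHom ℚ) := by
  have hinj : Function.Injective (Algebra.lsmul ℚ ℚ K : K →ₐ[ℚ] Module.End ℚ K) := fun x y h => by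
    simpa using LinearMap.congr_fun h (1 : K)
  have hmin : minpoly ℚ (rootEnd (f := f) K K) = f.map (Int.castRingHom ℚ) := by
    rw [minpoly.algHom_eq _ hinj, minpoly_root K hf]
  have hdvd := LinearMap.minpoly_dvd_charpoly (rootEnd (f := f) K K)
  rw [hmin] at hdvd
  refine (eq_of_monic_of_dvd_of_natDegree_le (hf.map _) (LinearMap.charpoly_monic _) hdvd ?_)
  rw [LinearMap.charpoly_natDegree, finrank_order K hf, hf.natDegree_map]

theorem charpoly_rootEnd_pi [FiniteDimensional ℚ K] (hf : f.Monic) (N : ℕ) :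
    LinearMap.charpoly (rootEnd (f := f) K (Fin N → K)) = f.map (Int.castRingHom ℚ) ^ N := by
  induction N with
  | zero =>
    rw [pow_zero]
    refine (LinearMap.charpoly_monic _).natDegree_eq_zero.1 ?_
    rw [LinearMap.charpoly_natDegree]
    exact Module.finrank_zero_of_subsingleton
  | succ N ih =>
    let e : (K × (Fin N → K)) ≃ₗ[ℚ] (Fin (N + 1) → K) :=
      (Fin.consLinearEquiv K fun _ : Fin (N + 1) => K).restrictScalars ℚ
    have he : e.conj ((rootEnd (f := f) K K).prodMap (rootEnd (f := f) K (Fin N → K))) =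
        rootEnd (f := f) K (Fin (N + 1) → K) := by
      refine LinearMap.ext fun v => ?_
      obtain ⟨p, rfl⟩ := e.surjective v
      rw [LinearEquiv.conj_apply_apply, LinearEquiv.symm_apply_apply]
      exact (Fin.consLinearEquiv K fun _ : Fin (N + 1) => K).map_smul _ p
    rw [← he, LinearEquiv.charpoly_conj, LinearMap.charpoly_prodMap, ih, charpoly_rootEnd_self K hf,
      pow_succ']

variable {K} {V M : Type*} [AddCommGroup V] [Module ℚ V] [Module K V] [IsScalarTower ℚ K V]
  [Module (AdjoinRoot f) V] [IsScalarTower (AdjoinRoot f) K V] [AddCommGroup M]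
  [Module (AdjoinRoot f) M] (j : M →ₗ[AdjoinRoot f] V)

omit [IsFractionRing (AdjoinRoot f) K] in
/-- In a `ℤ`-basis of a full lattice, the root acts on the lattice and on the ambient space by the
same matrix. -/
theorem exists_basis_toMatrix_rootEnd (hj : Function.Injective j)
    (hfull : ∀ x : V, ∃ n : ℤ, n ≠ 0 ∧ ∃ m, j m = n • x) {n : ℕ} (w : Module.Basis (Fin n) ℤ M) :
    ∃ b : Module.Basis (Fin n) ℚ V, LinearMap.toMatrix b b (rootEnd (f := f) K V) =
      (LinearMap.toMatrix w w (DistribSMul.toAddMonoidHom M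
        (AdjoinRoot.root f)).toIntLinearMap).map (Int.castRingHom ℚ) := by
  have := isLocalizedModule_lattice j hj hfull
  let b := w.ofIsLocalizedModule ℚ (nonZeroDivisors ℤ) (j.restrictScalars ℤ)
  refine ⟨b, ?_⟩
  ext i k
  have h : rootEnd (f := f) K V (b k) = j.restrictScalars ℤ (AdjoinRoot.root f • w k) := by
    rw [Module.Basis.ofIsLocalizedModule_apply]
    change algebraMap (AdjoinRoot f) K (AdjoinRoot.root f) • j (w k) = j _
    rw [algebraMap_smul, map_smul]
  rw [LinearMap.toMatrix_apply, h, Module.Basis.ofIsLocalizedModule_repr_apply]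
  simp [LinearMap.toMatrix_apply]

/-- A full lattice in `K ^ N` with `N ≥ 1` gives a matrix with minimal polynomial `f` and
characteristic polynomial `f ^ N`. -/
theorem exists_isMatrixOfRoot (hf : f.Monic) {N : ℕ} (hN : 0 < N) {c : ℤ[X]} (hc : c = f ^ N)
    (j : M →ₗ[AdjoinRoot f] (Fin N → K)) (hj : Function.Injective j)
    (hfull : ∀ x : Fin N → K, ∃ n : ℤ, n ≠ 0 ∧ ∃ m, j m = n • x)
    (hfin : Module.Finite (AdjoinRoot f) M) :
    ∃ A : IntMatrices f c, IsMatrixOfRoot f A.1 M := by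
  have := finiteDimensional_order K hf
  have := hf.finite_adjoinRoot
  have : Module.Finite ℤ M := Module.Finite.trans (AdjoinRoot f) M
  have := torsionFree_of_injective (j.restrictScalars ℤ) hj
  have hrank : Module.finrank ℤ M = c.natDegree := by
    obtain ⟨b, -⟩ := exists_basis_toMatrix_rootEnd (K := K) j hj hfull (Module.finBasis ℤ M)
    have h := Module.finrank_eq_card_basis b
    rw [Module.finrank_pi_fintype, Finset.sum_const, finrank_order K hf, Finset.card_univ,
      Fintype.card_fin, Fintype.card_fin] at h
    rw [← h, hc, hf.natDegree_pow, smul_eq_mul]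
  let w := Module.finBasisOfFinrankEq ℤ M hrank
  obtain ⟨b, hb⟩ := exists_basis_toMatrix_rootEnd (K := K) j hj hfull w
  refine ⟨⟨_, ?_, ?_⟩, w, rfl⟩
  · rw [← hb]
    have hinj : Function.Injective
        (Algebra.lsmul ℚ ℚ (Fin N → K) : K →ₐ[ℚ] Module.End ℚ (Fin N → K)) := fun x y h => by
      simpa using congrFun (LinearMap.congr_fun h (fun _ => (1 : K))) ⟨0, hN⟩
    change minpoly ℚ (LinearMap.toMatrixAlgEquiv b _) = _
    rw [minpoly.algEquiv_eq, minpoly.algHom_eq _ hinj, minpoly_root K hf]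
  · apply Polynomial.map_injective (Int.castRingHom ℚ) Int.cast_injective
    rw [← Matrix.charpoly_map, ← hb, LinearMap.charpoly_toMatrix, charpoly_rootEnd_pi K hf, hc,
      Polynomial.map_pow]

/-- The `ℤ[x]/(f)`-module structure on `ℤ ^ n` in which `x` acts by `A`. -/
@[reducible] noncomputable def matrixModule {n : ℕ} (A : Matrix (Fin n) (Fin n) ℤ)
    (hA : aeval (Matrix.toLin' A) f = 0) : Module (AdjoinRoot f) (Fin n → ℤ) :=
  Module.compHom _ (Ideal.Quotient.lift (Ideal.span {f})
    (aeval (Matrix.toLin' A) : ℤ[X] →ₐ[ℤ] Module.End ℤ (Fin n → ℤ)).toRingHom fun p hp => by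
      obtain ⟨q, rfl⟩ := Ideal.mem_span_singleton'.1 hp
      change aeval (Matrix.toLin' A) (q * f) = 0
      rw [map_mul, hA, mul_zero] : AdjoinRoot f →+* Module.End ℤ (Fin n → ℤ))

theorem isMatrixOfRoot_matrixModule {n : ℕ} (A : Matrix (Fin n) (Fin n) ℤ)
    (hA : aeval (Matrix.toLin' A) f = 0) :
    letI := matrixModule A hA
    IsMatrixOfRoot f A (Fin n → ℤ) := by
  let := matrixModule A hA
  refine ⟨Pi.basisFun ℤ (Fin n), ?_⟩
  have : (DistribSMul.toAddMonoidHom (Fin n → ℤ) (AdjoinRoot.root f)).toIntLinearMap =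
      Matrix.toLin' A := by
    refine LinearMap.ext fun v => ?_
    change aeval (Matrix.toLin' A) (X : ℤ[X]) v = _
    rw [aeval_X]
  rw [this]
  exact LinearMap.toMatrix'_toLin' A

open TensorProduct in
/-- Every finite torsion-free `ℤ[x]/(f)`-module on which the root acts with characteristic
polynomial `f ^ N` is a full lattice in `K ^ N`: by comparison of characteristic polynomials, every
element of `K` has `N` times its trace on the extension of scalars to `K`. -/
theorem exists_lattice_of_charpoly (K : Type u) [CommRing K] [Algebra (AdjoinRoot f) K]
    [IsFractionRing (AdjoinRoot f) K] [Algebra ℚ K] (hf : f.Monic) (hsq : Squarefree f) (N : ℕ)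
    {M : Type v} [AddCommGroup M] [Module (AdjoinRoot f) M] [Module.IsTorsionFree ℤ M]
    {n : ℕ} {A : Matrix (Fin n) (Fin n) ℤ} (hA : A.charpoly = f ^ N) (hM : IsMatrixOfRoot f A M) :
    ∃ L : Submodule (AdjoinRoot f) (Fin N → K), IsFullLattice (AdjoinRoot f) L ∧
      IsMatrixOfRoot f A L := by
  have := finiteDimensional_order K hf
  have := isReduced_of_order K hf hsq
  have hM' := hM
  obtain ⟨w, hw⟩ := hM'
  let V := K ⊗[AdjoinRoot f] M
  let j : M →ₗ[AdjoinRoot f] V := TensorProduct.mk (AdjoinRoot f) K M 1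
  have hloc : IsLocalizedModule (nonZeroDivisors (AdjoinRoot f)) j := inferInstance
  have hj : Function.Injective j := by
    rw [injective_iff_map_eq_zero]
    intro m hm
    obtain ⟨s, hs⟩ := (IsLocalizedModule.eq_zero_iff (nonZeroDivisors (AdjoinRoot f)) j).1 hm
    obtain ⟨k, hk, t, ht⟩ := exists_dvd_intCast hf s.2
    have : k • m = 0 := by
      rw [← Int.cast_smul_eq_zsmul (AdjoinRoot f), ht, mul_comm, mul_smul]
      change t • (s • m) = 0
      rw [hs, smul_zero]
    exact (smul_eq_zero.1 this).resolve_left hk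
  have hfull : ∀ x : V, ∃ k : ℤ, k ≠ 0 ∧ ∃ m, j m = k • x := fun x => by
    obtain ⟨⟨m, s⟩, hx⟩ := IsLocalizedModule.surj (nonZeroDivisors (AdjoinRoot f)) j x
    obtain ⟨k, hk, t, ht⟩ := exists_dvd_intCast hf s.2
    refine ⟨k, hk, t • m, ?_⟩
    rw [map_smul, ← hx, ← Int.cast_smul_eq_zsmul (AdjoinRoot f), ht, mul_comm, mul_smul]
    rfl
  obtain ⟨b, hb⟩ := exists_basis_toMatrix_rootEnd (K := K) j hj hfull w
  have : FiniteDimensional ℚ V := b.finiteDimensional_of_finite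
  have hchar : LinearMap.charpoly (rootEnd (f := f) K V) =
      LinearMap.charpoly (rootEnd (f := f) K (Fin N → K)) := by
    rw [charpoly_rootEnd_pi K hf, ← LinearMap.charpoly_toMatrix _ b, hb, hw, Matrix.charpoly_map,
      hA, Polynomial.map_pow]
  obtain ⟨e⟩ := nonempty_equiv_pi_of_scalarTrace (K := K) (V := V) (N := N) fun x => by
    obtain ⟨g, rfl⟩ := exists_eq_aeval_root K hf x
    rw [← scalarTrace_pi, scalarTrace, scalarTrace,
      ← aeval_algHom_apply (Algebra.lsmul ℚ ℚ V : K →ₐ[ℚ] Module.End ℚ V),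
      ← aeval_algHom_apply (Algebra.lsmul ℚ ℚ (Fin N → K) : K →ₐ[ℚ] Module.End ℚ (Fin N → K))]
    exact trace_aeval_eq_of_charpoly_eq hchar g
  let j' : M →ₗ[AdjoinRoot f] (Fin N → K) := (e.restrictScalars (AdjoinRoot f)).toLinearMap ∘ₗ j
  have hj' : Function.Injective j' := e.injective.comp hj
  have hfin : Module.Finite (AdjoinRoot f) M := by
    have : Module.Finite ℤ M := Module.Finite.of_basis w
    exact Module.Finite.of_restrictScalars_finite ℤ (AdjoinRoot f) M
  refine ⟨LinearMap.range j', ⟨?_, fun x => ?_⟩, hM.congr (LinearEquiv.ofInjective j' hj')⟩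
  · rw [LinearMap.range_eq_map]
    exact hfin.fg_top.map _
  · obtain ⟨k, hk, m, hm⟩ := hfull (e.symm x)
    refine ⟨k, hk, m, ?_⟩
    change e (j m) = k • x
    rw [hm, map_zsmul, LinearEquiv.apply_symm_apply]

/-- Every matrix with minimal polynomial `f` and characteristic polynomial `f ^ N` comes from a full
lattice in `K ^ N`. -/
theorem exists_lattice_of_intMatrices (K : Type u) [CommRing K] [Algebra (AdjoinRoot f) K]
    [IsFractionRing (AdjoinRoot f) K] [Algebra ℚ K] (hf : f.Monic) (hsq : Squarefree f) (N : ℕ)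
    {c : ℤ[X]} (hc : c = f ^ N) (A : IntMatrices f c) :
    ∃ L : Submodule (AdjoinRoot f) (Fin N → K), IsFullLattice (AdjoinRoot f) L ∧
      IsMatrixOfRoot f A.1 L := by
  obtain ⟨A, hmin, hchar⟩ := A
  have h0 : aeval A f = 0 := by
    have h := minpoly.aeval ℚ (A.map (Int.castRingHom ℚ))
    rw [hmin, ← algebraMap_int_eq, aeval_map_algebraMap] at h
    have hφ := aeval_algHom_apply ((Algebra.ofId ℤ ℚ).mapMatrix :
      Matrix (Fin c.natDegree) (Fin c.natDegree) ℤ →ₐ[ℤ] _) A f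
    have hz : (aeval A f).map (algebraMap ℤ ℚ) = 0 := hφ.symm.trans h
    refine Matrix.map_injective (f := algebraMap ℤ ℚ) Int.cast_injective ?_
    exact hz.trans (Matrix.map_zero _ (map_zero _)).symm
  have hA : aeval (Matrix.toLin' A) f = 0 := by
    have := aeval_algHom_apply (Matrix.toLinAlgEquiv' : Matrix _ _ ℤ ≃ₐ[ℤ] _) A f
    rw [h0, map_zero] at this
    exact this
  let := matrixModule A hA
  exact exists_lattice_of_charpoly K hf hsq N (hchar.trans hc) (isMatrixOfRoot_matrixModule A hA)

end Matrices

end OrderLattice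

open OrderLattice in
theorem mainTheorem3 (f : ℤ[X]) (hf : f.Monic) (hsq : Squarefree f)
    (K : Type u) [CommRing K] [Algebra (AdjoinRoot f) K] [IsFractionRing (AdjoinRoot f) K] :
    (∃ e : MatrixClasses f f ≃ ICM (AdjoinRoot f) K,
      ∀ (A : IntMatrices f f) (I : FracIdeal (AdjoinRoot f) K),
        e (MatrixClasses.mk A) = ICM.mk I ↔ IsMatrixOfRoot f A.1 I.1) ∧
    (IsBassOrder (AdjoinRoot f) K → ∀ (N : ℕ) (hN : 0 < N),
      (∃ e : MatrixClasses f (f ^ N) ≃ ChainClasses (AdjoinRoot f) K N,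
        ∀ (A : IntMatrices f (f ^ N)) (I : FracIdealChain (AdjoinRoot f) K N),
          e (MatrixClasses.mk A) = ChainClasses.mk I ↔ IsMatrixOfRoot f A.1 I.directSum) ∧
      (∀ I J : FracIdealChain (AdjoinRoot f) K N,
        Nonempty (I.directSum ≃ₗ[AdjoinRoot f] J.directSum) ↔
          (∀ i, (I.1 i).multRing = (J.1 i).multRing) ∧
            ICM.mk (FracIdeal.prod hN I.1) = ICM.mk (FracIdeal.prod hN J.1))) := by
  let : Algebra ℚ K := ratAlgebra K hf
  have := finiteDimensional_order K hf
  have := isReduced_of_order K hf hsq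
  have := hf.finite_adjoinRoot
  have h1 := isFracIdeal_one K hf
  refine ⟨?_, fun hB N hN => ⟨?_, nonempty_directSum_equiv_iff h1 hB hN⟩⟩
  · refine exists_matrixClasses_equiv (FracIdeal.isoSetoid (AdjoinRoot f) K) (fun I => I.1)
      (fun _ _ => Iff.rfl) (fun I => ?_) fun A => ?_
    · refine exists_isMatrixOfRoot hf one_pos (pow_one f).symm
        (LinearMap.pi fun _ => I.1.subtype) (fun x y h => Subtype.ext (congrFun h 0)) (fun x => ?_)
        (Module.Finite.iff_fg.2 I.2.fg)
      obtain ⟨n, hn, hx⟩ := I.2.full (x 0)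
      refine ⟨n, hn, ⟨_, hx⟩, funext fun i => ?_⟩
      rw [Subsingleton.elim i 0]
      rfl
    · obtain ⟨L, hL, hLA⟩ := exists_lattice_of_intMatrices K hf hsq 1 (pow_one f).symm A
      let p : (Fin 1 → K) ≃ₗ[AdjoinRoot f] K := LinearEquiv.funUnique (Fin 1) (AdjoinRoot f) K
      refine ⟨⟨L.map p.toLinearMap, hL.fg.map _, fun x => ?_⟩, hLA.congr (p.submoduleMap L)⟩
      obtain ⟨n, hn, hx⟩ := hL.full (p.symm x)
      refine ⟨n, hn, _, hx, ?_⟩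
      change p (n • p.symm x) = n • x
      rw [map_zsmul, LinearEquiv.apply_symm_apply]
  · refine exists_matrixClasses_equiv (FracIdealChain.isoSetoid (AdjoinRoot f) K N)
      (fun I => I.directSum) (fun _ _ => Iff.rfl) (fun I => ?_) fun A => ?_
    · have (i : Fin N) : Module.Finite (AdjoinRoot f) (I.1 i).1 :=
        Module.Finite.iff_fg.2 (I.1 i).2.fg
      refine exists_isMatrixOfRoot hf hN rfl
        (LinearMap.pi fun i => (I.1 i).1.subtype ∘ₗ LinearMap.proj i)
        (fun x y h => funext fun i => Subtype.ext (congrFun h i)) (fun x => ?_) inferInstance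
      choose n hn hx using fun i => (I.1 i).2.full (x i)
      refine ⟨∏ i, n i, Finset.prod_ne_zero_iff.2 fun i _ => hn i, fun i => ⟨(∏ i, n i) • x i, ?_⟩,
        rfl⟩
      rw [← Finset.prod_erase_mul _ _ (Finset.mem_univ i), mul_smul]
      exact Submodule.smul_of_tower_mem _ _ (hx i)
    · obtain ⟨L, hL, hLA⟩ := exists_lattice_of_intMatrices K hf hsq N rfl A
      obtain ⟨I, hI, -, ⟨e⟩⟩ := exists_chain_equiv h1 hB N L hL
      exact ⟨⟨I, hI⟩, hLA.congr e⟩
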